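/- Let $\Omega\subseteq\mathbb R^n$ be open, $X=\mathbb R^m$, and let $Z$ be a Hausdorff real topological vector space in which every bounded subset $E$ is relatively complete (its closure is complete) and perfect (every family in $Z$ all of whose finite partial sums lie in $E$ is unconditionally summable). Let $\mathcal G$ be the family of open subsets of $\Omega$, $\mathcal B$ the family of nonempty closed, balanced, totally bounded subsets of $X$, and let $(\mathcal F,\mathcal K)$ be one of the following pairs: (i) $\mathcal F=\mathcal C_p(\Omega,\mathbb R^m)$, the continuous functions $\Omega\to\mathbb R^m$ with totally bounded range, and $\mathcal K$ the closed subsets of $\Omega$; (ii) $\mathcal F=\mathcal C_c^\infty(\Omega,\mathbb R^m)$, the infinitely differentiable functions with compact support in $\Omega$, and $\mathcal K$ the compact subsets of $\Omega$. Let $\ell:\mathcal F\to Z$ be linear and continuous for the topology of uniform convergence on $\Omega$. Then $\ell$ has the integral representation $$\ell(f)=\int_\Omega f\,d\nu_\ell\qquad\text{for all } f\in\mathcal F,$$ where $\nu_\ell$, the set function generated by $\ell$, exists and is a Riesz measure over $(\mathcal K,\mathcal G,\mathcal B)$. Here the terms have the following meaning. *Generation of $\nu_\ell$.* For $f:\Omega\to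 X$ write $f\prec\alpha$ if $f$ vanishes off some $\kappa\in\mathcal K$ with $\kappa\subseteq\alpha$, and say that $f$ equals $x$ over $\alpha$ if $f=x$ on some $\gamma\in\mathcal G$ with $\gamma\supseteq\alpha$. For $\kappa\in\mathcal K$ and $x\in X$, $\tau_\ell(\kappa)(x)$ is the limit of the filter base of the sets $\{\ell(f): f\in\mathcal F,\ f(\Omega)\subseteq B,\ f \text{ equals } x \text{ over } \kappa,\ f\prec\beta\}$, $\beta\in\mathcal G$, $\beta\supseteq\kappa$ (for every $B\in\mathcal B$ containing $x$, with a limit independent of $B$). Then $\xi_\ell(\gamma)=\lim_{\kappa\in\mathcal K,\kappa\subseteq\gamma}\tau_\ell(\kappa)$ for $\gamma\in\mathcal G$ and $\nu_\ell(\alpha)=\lim_{\gamma\in\mathcal G,\gamma\supseteq\alpha}\xi_\ell(\gamma)$ for every $\alpha\subseteq\Omega$, pointwise on $X$; that these limits exist is part of the assertion. *Riesz measures.* Let $h$ assign to each subset of $\Omega$ a map $X\to Z$; write $x.h(\alpha)=h(\alpha)(x)$. For an entourage $W$ of $Z$ and $B\in\mathcal B$, a set $\alpha$ is $W$-small for $(h,B)$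 if there is $\gamma\in\mathcal G$, $\gamma\supseteq\alpha$, with $\big(\sum_{\kappa\in L}x_\kappa.h(\kappa),\sum_{\kappa\in L}(x_\kappa+y_\kappa).h(\kappa)\big)\in W$ for all finite disjoint $L\subseteq\mathcal K$ with $\bigcup L\subseteq\gamma$ and all $x,y:L\to B$. $\mathcal R_h$ is the family of sets $\alpha$ such that for all $B\in\mathcal B$ and entourages $V$ there are $\kappa\in\mathcal K$, $\gamma\in\mathcal G$ with $\kappa\subseteq\alpha\subseteq\gamma$ and $\gamma\setminus\kappa$ $V$-small for $(h,B)$. $h$ is a Riesz measure if: (1) $\mathcal G\subseteq\mathcal R_h$; (2) $\mathcal R_h$ is a field of sets on which $h$ is additive, with $h(\emptyset)=0$; (3) $h(\gamma)=\lim_{\kappa\in\mathcal K,\kappa\subseteq\gamma}h(\kappa)$ and $h(\alpha)=\lim_{\gamma\in\mathcal G,\gamma\supseteq\alpha}h(\gamma)$ pointwise on $X$, for all $\gamma\in\mathcal G$, $\alpha\subseteq\Omega$; (4) for every entourage $W$ of $Z$ and $B\in\mathcal B$ there is an entourage $U$ of $X$ such that $\big(\sum_{\rho\in R}x_\rho.h(\rho),\sum_{\rho\in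 R}y_\rho.h(\rho)\big)\in W$ for all finite disjoint $R\subseteq\mathcal R_h$ and $x,y:R\to B$ with $(x_\rho,y_\rho)\in U$ for all $\rho\in R$; (5) for every $B\in\mathcal B$, entourage $V$ and disjoint sequence $(\alpha_k)$ in $\mathcal R_h$, $\alpha_k$ is $V$-small for $(h,B)$ for all large $k$; (6) for every $B\in\mathcal B$, the set of all sums $\sum_{\rho\in R}x_\rho.h(\rho)$, with $R\subseteq\mathcal R_h$ finite and disjoint and $x:R\to B$, is relatively complete. *Integral.* $\int_\Omega f\,dh=z$ means that for each neighbourhood $V$ of $z$ there is a finite partition $Q$ of $\Omega$ into members of $\mathcal R_h$ such that $\sum_{\rho\in R}f(s_\rho).h(\rho)\in V$ for every finite partition $R$ of $\Omega$ into members of $\mathcal R_h$ finer than $Q$ and every choice of points $s_\rho\in\rho$. -/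

import Mathlib

open Set Filter Topology

/-! ### Summability and completeness conditions on the range space -/

/-- A subset `E` is perfect if every family all of whose finite partial sums lie in `E` is
(unconditionally) summable. The index sets are taken in the lowest universe, which contains
`ℕ`. -/
def PerfectForSums {Z : Type*} [AddCommMonoid Z] [TopologicalSpace Z] (E : Set Z) : Prop :=
  ∀ (ι : Type) (f : ι → Z), (∀ J : Finset ι, ∑ j ∈ J, f j ∈ E) → Summable f

/-- A subset is relatively complete if its closure is complete. -/
def RelativelyComplete {Z : Type*} [UniformSpace Z] (E : Set Z) : Prop :=
  IsComplete (closure E)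

/-! ### The families of sets and of functions -/

/-- The closed, balanced, totally bounded (nonempty) subsets of `X`. -/
def closedBalancedTotallyBounded (X : Type*) [AddCommGroup X] [Module ℝ X] [UniformSpace X] :
    Set (Set X) :=
  {B | B.Nonempty ∧ IsClosed B ∧ Balanced ℝ B ∧ TotallyBounded B}

/-- `C_p(S, X)`: the continuous functions from `S` to `X` with totally bounded range. -/
def Cp (S X : Type*) [TopologicalSpace S] [AddCommGroup X] [Module ℝ X] [UniformSpace X]
    [IsUniformAddGroup X] [ContinuousSMul ℝ X] : Submodule ℝ (S → X) where
  carrier := {f | Continuous f ∧ TotallyBounded (range f)}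
  zero_mem' := by
    refine ⟨continuous_const, (Set.Finite.subset (Set.finite_singleton (0 : X)) ?_).totallyBounded⟩
    rintro _ ⟨s, rfl⟩
    simp
  add_mem' := by
    rintro f g ⟨hf, hf'⟩ ⟨hg, hg'⟩
    refine ⟨hf.add hg, ?_⟩
    have h : TotallyBounded (range f ×ˢ range g) := by
      rw [totallyBounded_iff_ultrafilter]
      intro u hu
      have h1 := totallyBounded_iff_ultrafilter.1 hf' (u.map Prod.fst)
        (le_principal_iff.2 (mem_of_superset (x := range f ×ˢ range g) (le_principal_iff.1 hu)
          fun p hp => hp.1))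
      have h2 := totallyBounded_iff_ultrafilter.1 hg' (u.map Prod.snd)
        (le_principal_iff.2 (mem_of_superset (x := range f ×ˢ range g) (le_principal_iff.1 hu)
          fun p hp => hp.2))
      exact (h1.prod h2).mono le_prod_map_fst_snd
    refine (h.image (uniformContinuous_add (α := X))).subset ?_
    rintro _ ⟨s, rfl⟩
    exact ⟨(f s, g s), ⟨⟨s, rfl⟩, ⟨s, rfl⟩⟩, rfl⟩
  smul_mem' := by
    rintro c f ⟨hf, hf'⟩
    refine ⟨hf.const_smul c, (hf'.image (f := fun x : X => c • x) ?_).subset ?_⟩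
    · exact uniformContinuous_addMonoidHom_of_continuous
        (f := DistribSMul.toAddMonoidHom X c) (continuous_const_smul c)
    rintro _ ⟨s, rfl⟩
    exact ⟨f s, ⟨s, rfl⟩, rfl⟩

/-- `C_c^∞(Ω, X)`: the infinitely differentiable functions with compact support contained in
the open set `Ω`, regarded as functions on `Ω`. -/
def CcSmooth {E : Type*} [NormedAddCommGroup E] [NormedSpace ℝ E]
    (Ω : TopologicalSpace.Opens E) (X : Type*) [NormedAddCommGroup X] [NormedSpace ℝ X] :
    Submodule ℝ (Ω → X) where
  carrier := {f | ∃ g : TestFunction Ω X ⊤, ∀ s : Ω, f s = g s}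
  zero_mem' := ⟨0, fun _ => rfl⟩
  add_mem' := by
    rintro f g ⟨f', hf⟩ ⟨g', hg⟩
    exact ⟨f' + g', fun s => by simp [hf s, hg s]⟩
  smul_mem' := by
    rintro c f ⟨f', hf⟩
    exact ⟨c • f', fun s => by simp [hf s]⟩

section RieszMeasures

variable {S X Z : Type*} [AddCommGroup X] [Module ℝ X] [UniformSpace X]
  [AddCommGroup Z] [Module ℝ Z] [UniformSpace Z]

/-- Continuity of `ℓ` for the topology of uniform convergence on `S`. -/
def ContinuousForUniformConvergence (F : Submodule ℝ (S → X)) (ℓ : F →ₗ[ℝ] Z) : Prop :=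
  Continuous[TopologicalSpace.induced (fun f : F => UniformFun.ofFun (f : S → X)) inferInstance,
    inferInstance] ℓ

/-! ### Small and regular sets, Riesz measures

A `Z^X`-valued set function is a function `h : Set S → X → Z`, and `x.h(α)` is `h α x`.
The fixed data are families `K` and `G` of subsets of `S` and a family `𝓑` of subsets of `X`. -/

/-- `α` is `W`-small with respect to `(h, B)`; only the restriction of `h` to `K` is used. -/
def IsSmall (K G : Set (Set S)) (h : Set S → X → Z) (B : Set X) (W : Set (Z × Z))
    (α : Set S) : Prop :=
  ∃ γ ∈ G, α ⊆ γ ∧ ∀ L : Finset (Set S), (L : Set (Set S)) ⊆ K →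
    (L : Set (Set S)).PairwiseDisjoint id → (∀ κ ∈ L, κ ⊆ γ) →
    ∀ x y : Set S → X, (∀ κ ∈ L, x κ ∈ B) → (∀ κ ∈ L, y κ ∈ B) →
      (∑ κ ∈ L, h κ (x κ), ∑ κ ∈ L, h κ (x κ + y κ)) ∈ W

/-- The family `R_h` of all sets that are regular with respect to `(h, K, G, 𝓑)`. -/
def regularSets (K G : Set (Set S)) (𝓑 : Set (Set X)) (h : Set S → X → Z) : Set (Set S) :=
  {α | ∀ B ∈ 𝓑, ∀ V ∈ uniformity Z, ∃ κ ∈ K, ∃ γ ∈ G,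
    κ ⊆ α ∧ α ⊆ γ ∧ IsSmall K G h B V (γ \ κ)}

/-- `Z^X`-valued Riesz measures over `(K, G, 𝓑)`. -/
structure IsRieszMeasure (K G : Set (Set S)) (𝓑 : Set (Set X)) (h : Set S → X → Z) : Prop where
  subset_regularSets : G ⊆ regularSets K G 𝓑 h
  isSetAlgebra : MeasureTheory.IsSetAlgebra (regularSets K G 𝓑 h)
  map_empty : h ∅ = 0
  additive : ∀ α ∈ regularSets K G 𝓑 h, ∀ β ∈ regularSets K G 𝓑 h,
    h (α ∪ β) + h (α ∩ β) = h α + h β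
  inner_limit : ∀ γ ∈ G, ∀ x : X,
    Tendsto (fun κ : {κ : Set S // κ ∈ K ∧ κ ⊆ γ} => h κ x) atTop (𝓝 (h γ x))
  outer_limit : ∀ α : Set S, ∀ x : X,
    Tendsto (fun γ : {γ : Set S // γ ∈ G ∧ α ⊆ γ} => h γ x) atBot (𝓝 (h α x))
  /-- uniform partition continuity -/
  partition_continuous : ∀ W ∈ uniformity Z, ∀ B ∈ 𝓑, ∃ U ∈ uniformity X,
    ∀ R : Finset (Set S), (R : Set (Set S)) ⊆ regularSets K G 𝓑 h →
      (R : Set (Set S)).PairwiseDisjoint id →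
      ∀ x y : Set S → X, (∀ ρ ∈ R, x ρ ∈ B) → (∀ ρ ∈ R, y ρ ∈ B) →
        (∀ ρ ∈ R, (x ρ, y ρ) ∈ U) → (∑ ρ ∈ R, h ρ (x ρ), ∑ ρ ∈ R, h ρ (y ρ)) ∈ W
  s_bounded : ∀ B ∈ 𝓑, ∀ α : ℕ → Set S, (∀ n, α n ∈ regularSets K G 𝓑 h) →
    Pairwise (fun i j => Disjoint (α i) (α j)) →
    ∀ V ∈ uniformity Z, ∃ m : ℕ, ∀ n > m, IsSmall K G h B V (α n)
  relativelyComplete_sums : ∀ B ∈ 𝓑, RelativelyComplete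
    {z : Z | ∃ (R : Finset (Set S)) (x : Set S → X),
      (R : Set (Set S)) ⊆ regularSets K G 𝓑 h ∧ (R : Set (Set S)).PairwiseDisjoint id ∧
      (∀ ρ ∈ R, x ρ ∈ B) ∧ z = ∑ ρ ∈ R, h ρ (x ρ)}

/-! ### The integral -/

/-- `R` is a finite partition of `E` into regular sets. -/
def IsRegularPartition (K G : Set (Set S)) (𝓑 : Set (Set X)) (h : Set S → X → Z) (E : Set S)
    (R : Finset (Set S)) : Prop :=
  (R : Set (Set S)) ⊆ regularSets K G 𝓑 h ∧ (R : Set (Set S)).PairwiseDisjoint id ∧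
    ⋃₀ (R : Set (Set S)) = E

/-- `f` is integrable over `E` with respect to `h`, with integral `z`: the sums
`∑ f(s_ρ).h(ρ)` over finite regular partitions of `E` and choice functions `s` converge
to `z` under refinement. -/
def HasRieszIntegral (K G : Set (Set S)) (𝓑 : Set (Set X)) (h : Set S → X → Z) (E : Set S)
    (f : S → X) (z : Z) : Prop :=
  ∀ V ∈ 𝓝 z, ∃ Q : Finset (Set S), IsRegularPartition K G 𝓑 h E Q ∧
    ∀ R : Finset (Set S), IsRegularPartition K G 𝓑 h E R → (∀ ρ ∈ R, ∃ q ∈ Q, ρ ⊆ q) →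
      ∀ s : R → S, (∀ ρ : R, s ρ ∈ (ρ : Set S)) → ∑ ρ : R, h ρ (f (s ρ)) ∈ V

/-! ### The Riesz measure of a linear map -/

/-- `f ≺ α`: the function `f` is supported by `α`. -/
def SupportedBy (K : Set (Set S)) (f : S → X) (α : Set S) : Prop :=
  ∃ κ ∈ K, κ ⊆ α ∧ ∀ s ∉ κ, f s = 0

/-- `f` equals `x` over `α`, that is, on some member of `G` containing `α`. -/
def EqualsOver (G : Set (Set S)) (f : S → X) (x : X) (α : Set S) : Prop :=
  ∃ γ ∈ G, α ⊆ γ ∧ ∀ s ∈ γ, f s = x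

/-- The intersection of all members of `𝓑` that contain `x`. -/
def hull (𝓑 : Set (Set X)) (x : X) : Set X := ⋂₀ {B ∈ 𝓑 | x ∈ B}

/-- The filter on `F` with base the sets of all `f ∈ F` with range in `B` that equal `x` over `κ`
and are supported by `β`, where `β` runs through the members of `G` containing `κ`. -/
def approxFilter (K G : Set (Set S)) (F : Submodule ℝ (S → X)) (x : X) (κ : Set S) (B : Set X) :
    Filter F :=
  ⨅ β ∈ {β ∈ G | κ ⊆ β}, 𝓟 {f : F | range (f : S → X) ⊆ B ∧ EqualsOver G (f : S → X) x κ ∧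
    SupportedBy K (f : S → X) β}

/-- The set function `τ_ℓ` (meaningful on `K`). -/
noncomputable def tauOf (K G : Set (Set S)) (𝓑 : Set (Set X)) (F : Submodule ℝ (S → X))
    (ℓ : F →ₗ[ℝ] Z) (κ : Set S) (x : X) : Z :=
  limUnder (approxFilter K G F x κ (hull 𝓑 x)) ℓ

/-- The set function `ξ_ℓ` (meaningful on `G`): the limit of `τ_ℓ(κ)` over `κ ∈ K`, `κ ⊆ γ`. -/
noncomputable def xiOf (K G : Set (Set S)) (𝓑 : Set (Set X)) (F : Submodule ℝ (S → X))
    (ℓ : F →ₗ[ℝ] Z) (γ : Set S) (x : X) : Z :=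
  limUnder atTop (fun κ : {κ : Set S // κ ∈ K ∧ κ ⊆ γ} => tauOf K G 𝓑 F ℓ κ x)

/-- The set function `ν_ℓ`: the limit of `ξ_ℓ(γ)` over `γ ∈ G`, `γ ⊇ α`. -/
noncomputable def nuOf (K G : Set (Set S)) (𝓑 : Set (Set X)) (F : Submodule ℝ (S → X))
    (ℓ : F →ₗ[ℝ] Z) (α : Set S) (x : X) : Z :=
  limUnder atBot (fun γ : {γ : Set S // γ ∈ G ∧ α ⊆ γ} => xiOf K G 𝓑 F ℓ γ x)

/-- The limits that define `ν_ℓ` exist, `ν_ℓ` is a Riesz measure, and every `f ∈ F` is integrable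
over `S` with respect to `ν_ℓ` with `∫ f dν_ℓ = ℓ(f)`. -/
structure RepresentedByRieszMeasure (K G : Set (Set S)) (𝓑 : Set (Set X))
    (F : Submodule ℝ (S → X)) (ℓ : F →ₗ[ℝ] Z) : Prop where
  approxFilter_neBot : ∀ κ ∈ K, ∀ x : X, ∀ B ∈ 𝓑, x ∈ B → (approxFilter K G F x κ B).NeBot
  tendsto_tau : ∀ κ ∈ K, ∀ x : X, ∀ B ∈ 𝓑, x ∈ B →
    Tendsto ℓ (approxFilter K G F x κ B) (𝓝 (tauOf K G 𝓑 F ℓ κ x))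
  tendsto_xi : ∀ γ ∈ G, ∀ x : X,
    Tendsto (fun κ : {κ : Set S // κ ∈ K ∧ κ ⊆ γ} => tauOf K G 𝓑 F ℓ κ x) atTop
      (𝓝 (xiOf K G 𝓑 F ℓ γ x))
  tendsto_nu : ∀ α : Set S, ∀ x : X,
    Tendsto (fun γ : {γ : Set S // γ ∈ G ∧ α ⊆ γ} => xiOf K G 𝓑 F ℓ γ x) atBot
      (𝓝 (nuOf K G 𝓑 F ℓ α x))
  isRieszMeasure : IsRieszMeasure K G 𝓑 (nuOf K G 𝓑 F ℓ)
  hasIntegral : ∀ f : F,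
    HasRieszIntegral K G 𝓑 (nuOf K G 𝓑 F ℓ) univ (f : S → X) (ℓ f)

end RieszMeasures

/-! Apart from continuity, two properties of ℓ carry the proof (`IsExhaustive`). The image of a
sup-norm ball is bounded, hence relatively complete, so Cauchy nets in its closure converge. If a
bounded sequence of functions has disjoint supports, all its finite sums stay in one ball;
perfectness makes the images summable, so they tend to 0.

Exhaustivity takes the place of finite variation. Call a set small if ℓ is small on the functions of
norm at most r supported near it. Greedily removing supports from an open γ must stop, so some κ ∈ K
inside γ leaves γ \ κ small (`exists_inner`); complements give outer regularity, and a disjoint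
sequence of regular sets has small members (`exists_smallOn`). Two approximants of x over κ differ
by a function living on β \ κ, so the nets defining τ, ξ and ν are Cauchy.

For finitely many disjoint regular sets ρ there are cutoffs φ_ρ with disjoint supports and ν(ρ)(y_ρ)
≈ ℓ(φ_ρ y_ρ) (`exists_disjoint_cutoffs`). A disjoint sum is no larger than its largest term, so sums
of ν are controlled by ℓ on a single ball. This gives partition continuity, relative completeness
and the integral formula (`exists_riemann_sum_le`); the last shows in turn that smallness for ν and
for ℓ define the same regular sets (`regularSets_genNu`).

Since Z need not be locally convex, the ε-estimates use continuous group seminorms, which generate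
the topology. The two pairs enter only through their cutoff functions (`IsCutoffSystem`). -/

/-! ### Continuous group seminorms -/

section GroupSeminorms

variable {Z : Type*} [AddCommGroup Z]

open NNReal in
/-- The chain construction of Birkhoff and Kakutani for a translation invariant gauge. -/
theorem exists_addGroupSeminorm_of_gauge (g : Z → ℝ≥0) (g_zero : g 0 = 0)
    (g_neg : ∀ z, g (-z) = g z)
    (hg : ∀ a b c, g (a + b + c) ≤ 2 * max (g a) (max (g b) (g c))) :
    ∃ p : AddGroupSeminorm Z, ∀ z, p z ≤ g z ∧ g z ≤ 2 * p z := by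
  set d : Z → Z → ℝ≥0 := fun x y => g (x - y) with hd
  have d_self : ∀ x, d x x = 0 := fun x => by simp [hd, g_zero]
  have d_comm : ∀ x y, d x y = d y x := fun x y => by
    simp only [hd]; rw [← g_neg, neg_sub]
  let I := PseudoMetricSpace.ofPreNNDist d d_self d_comm
  -- Translating a whole chain by c leaves its cost unchanged. So the chain distance is translation
  -- invariant and the distance to 0 is subadditive.
  have dist_add : ∀ x y c : Z, dist (x + c) (y + c) ≤ dist x y := by
    intro x y c
    change (((⨅ l : List Z, (((x + c)::l).zipWith d (l ++ [y + c])).sum : ℝ≥0)) : ℝ) ≤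
      ((⨅ l : List Z, ((x::l).zipWith d (l ++ [y])).sum : ℝ≥0) : ℝ)
    rw [NNReal.coe_le_coe]
    refine le_ciInf fun l => ?_
    refine (ciInf_le (OrderBot.bddBelow _) (l.map (· + c))).trans (le_of_eq ?_)
    congr 1
    have h1 : (x + c) :: l.map (· + c) = (x :: l).map (· + c) := rfl
    have h2 : l.map (· + c) ++ [y + c] = (l ++ [y]).map (· + c) := by simp
    rw [h1, h2, List.zipWith_map]
    congr 1
    funext a b
    simp [hd]
  have hle : ∀ x y, dist x y ≤ d x y := PseudoMetricSpace.dist_ofPreNNDist_le _ _ _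
  have hge : ∀ x y, (d x y : ℝ) ≤ 2 * dist x y := by
    refine PseudoMetricSpace.le_two_mul_dist_ofPreNNDist _ _ _ fun x₁ x₂ x₃ x₄ => ?_
    have := hg (x₁ - x₂) (x₂ - x₃) (x₃ - x₄)
    simpa [hd] using this
  refine ⟨{ toFun := fun z => dist z 0
            map_zero' := dist_self 0
            add_le' := fun a b => ?_
            neg' := fun a => le_antisymm ?_ ?_ }, fun z => ⟨?_, ?_⟩⟩
  · calc dist (a + b) 0 ≤ dist (a + b) b + dist b 0 := dist_triangle _ _ _
      _ ≤ dist a 0 + dist b 0 := by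
        have := dist_add a 0 b
        rw [zero_add] at this
        linarith
  · have := dist_add 0 a (-a)
    simpa [dist_comm] using this
  · have := dist_add (-a) 0 a
    simpa [dist_comm] using this
  · have := hle z 0
    simp only [hd, sub_zero] at this
    exact this
  · have := hge z 0
    simp only [hd, sub_zero] at this
    exact this

variable [TopologicalSpace Z] [IsTopologicalAddGroup Z]

/-- The continuous group seminorms generate the neighbourhoods of zero. -/
theorem exists_continuous_addGroupSeminorm {V : Set Z} (hV : V ∈ 𝓝 (0 : Z)) :
    ∃ p : AddGroupSeminorm Z, Continuous p ∧ ∀ z, p z < 1 → z ∈ V := by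
  classical
  have step : ∀ U : {U : Set Z // U ∈ 𝓝 (0 : Z)}, ∃ W : {U : Set Z // U ∈ 𝓝 (0 : Z)},
      (∀ z ∈ W.1, -z ∈ W.1) ∧ ∀ a ∈ W.1, ∀ b ∈ W.1, ∀ c ∈ W.1, a + b + c ∈ U.1 := by
    rintro ⟨U, hU⟩
    obtain ⟨W, hW, h⟩ := exists_nhds_zero_quarter hU
    refine ⟨⟨W ∩ -W, inter_mem hW (neg_mem_nhds_zero _ hW)⟩, ?_, ?_⟩
    · rintro z ⟨h1, h2⟩
      exact ⟨h2, by simpa using h1⟩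
    · intro a ha b hb c hc
      simpa using h ha.1 hb.1 hc.1 (mem_of_mem_nhds hW)
  choose nxt nxt_neg nxt_add using step
  -- The sequence starts at `nxt` of V rather than at V itself, so that the first set is symmetric
  -- as well.
  let U : ℕ → {U : Set Z // U ∈ 𝓝 (0 : Z)} := fun n => Nat.rec (nxt ⟨V, hV⟩) (fun _ W => nxt W) n
  have U_zero : U 0 = nxt ⟨V, hV⟩ := rfl
  have U_succ : ∀ n, U (n + 1) = nxt (U n) := fun n => rfl
  have U_neg : ∀ n z, z ∈ (U n).1 → -z ∈ (U n).1 := by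
    intro n
    cases n with
    | zero => exact nxt_neg _
    | succ n => exact nxt_neg _
  have U_add : ∀ n, ∀ a ∈ (U (n + 1)).1, ∀ b ∈ (U (n + 1)).1, ∀ c ∈ (U (n + 1)).1,
      a + b + c ∈ (U n).1 := fun n => nxt_add (U n)
  have U_mem_zero : ∀ n, (0 : Z) ∈ (U n).1 := fun n => mem_of_mem_nhds (U n).2
  have U_anti : Antitone fun n => (U n).1 := antitone_nat_of_succ_le fun n z hz => by
    simpa using U_add n z hz 0 (U_mem_zero (n + 1)) 0 (U_mem_zero (n + 1))
  have U_sub : (U 0).1 ⊆ V := fun z hz => by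
    have := nxt_add ⟨V, hV⟩ z hz 0 (U_mem_zero 0) 0 (U_mem_zero 0)
    simpa using this
  -- The gauge is 2⁻ⁿ for the first n with z outside U n, and 0 if there is none.
  set g : Z → NNReal := fun z => if h : ∃ n, z ∉ (U n).1 then (1 / 2) ^ Nat.find h else 0 with hgdef
  have hr0 : (0 : NNReal) < 1 / 2 := half_pos one_pos
  have hr1 : (1 / 2 : NNReal) < 1 := NNReal.half_lt_self one_ne_zero
  have hle_g : ∀ {z : Z} {n : ℕ}, (1 / 2) ^ n ≤ g z ↔ z ∉ (U n).1 := by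
    intro z n
    simp only [hgdef]
    split_ifs with h
    · rw [(pow_right_strictAnti₀ hr0 hr1).le_iff_ge, Nat.find_le_iff]
      exact ⟨fun ⟨m, hmn, hm⟩ hn => hm (U_anti hmn hn), fun h => ⟨n, le_rfl, h⟩⟩
    · push Not at h
      simp only [h, not_true, (pow_pos hr0 _).not_ge]
  have g_zero : g 0 = 0 := by
    simp only [hgdef]
    rw [dif_neg]
    push Not
    exact U_mem_zero
  have g_neg : ∀ z, g (-z) = g z := by
    intro z
    have : ∀ n, -z ∉ (U n).1 ↔ z ∉ (U n).1 := fun n =>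
      not_congr ⟨fun h => by simpa using U_neg n _ h, U_neg n z⟩
    simp only [hgdef, this]
  obtain ⟨p, hp⟩ := exists_addGroupSeminorm_of_gauge g g_zero g_neg (by
    intro a b c
    by_cases H : ∃ n, a + b + c ∉ (U n).1
    · refine (dif_pos H).trans_le ?_
      rw [← div_le_iff₀' zero_lt_two, ← mul_one_div (_ ^ _), ← pow_succ]
      simp only [le_max_iff, hle_g, ← not_and_or]
      rintro ⟨h₁, h₂, h₃⟩
      exact Nat.find_spec H (U_add (Nat.find H) _ h₁ _ h₂ _ h₃)
    · exact (dif_neg H).trans_le zero_le)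
  have p_small : ∀ ε : ℝ, 0 < ε → ∀ᶠ z in 𝓝 (0 : Z), p z < ε := by
    intro ε hε
    obtain ⟨n, hn⟩ := exists_pow_lt_of_lt_one hε (by norm_num : (1 / 2 : ℝ) < 1)
    filter_upwards [(U n).2] with z hz
    have h1 : g z < (1 / 2) ^ n := by
      rw [← not_le, hle_g, not_not]; exact hz
    have h2 : (g z : ℝ) < (1 / 2) ^ n := by exact_mod_cast h1
    linarith [(hp z).1]
  -- The factor 2 compensates g ≤ 2p: if 2p z < 1 then g z < 1, which means z ∈ U 0.
  refine ⟨(2 : ℕ) • p, ?_, fun z hz => U_sub ?_⟩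
  · have hc : Continuous p := by
      rw [continuous_iff_continuousAt]
      intro z
      rw [ContinuousAt, Metric.tendsto_nhds]
      intro ε hε
      have : Tendsto (fun w => w - z) (𝓝 z) (𝓝 0) := by
        have := (continuous_sub_right z).tendsto z
        rwa [sub_self] at this
      filter_upwards [this.eventually (p_small ε hε)] with w hw
      rw [Real.dist_eq]
      exact (abs_sub_map_le_sub p w z).trans_lt hw
    exact hc.const_smul (2 : ℕ)
  · have h1 : (g z : ℝ) < 1 := by
      have h3 : ((2 : ℕ) • p) z = (2 : ℕ) • p z := rfl
      rw [h3] at hz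
      have := (hp z).2
      simp at hz
      linarith
    by_contra h0
    have := (hle_g (n := 0)).2 h0
    rw [pow_zero] at this
    exact absurd (by exact_mod_cast this : (1 : ℝ) ≤ g z) (not_le.2 h1)

theorem mem_closure_of_addGroupSeminorm {A : Set Z} {z : Z}
    (h : ∀ p : AddGroupSeminorm Z, Continuous p → ∀ ε > 0, ∃ a ∈ A, p (z - a) ≤ ε) :
    z ∈ closure A := by
  rw [mem_closure_iff_nhds]
  intro V hV
  have hV' : (fun w => z - w) ⁻¹' V ∈ 𝓝 (0 : Z) := by
    apply (continuous_const.sub continuous_id).continuousAt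
    simpa using hV
  obtain ⟨p, hp, hpV⟩ := exists_continuous_addGroupSeminorm hV'
  obtain ⟨a, ha, hpa⟩ := h p hp (1 / 2) (by norm_num)
  refine ⟨a, ?_, ha⟩
  have := hpV (z - a) (by linarith)
  simpa using this

theorem eq_of_addGroupSeminorm [T2Space Z] {a b : Z}
    (h : ∀ p : AddGroupSeminorm Z, Continuous p → ∀ ε > 0, p (a - b) ≤ ε) : a = b := by
  have : a ∈ closure {b} := mem_closure_of_addGroupSeminorm fun p hp ε hε => ⟨b, rfl, h p hp ε hε⟩
  simpa using this

end GroupSeminorms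

section UniformGroup

variable {Z : Type*} [AddCommGroup Z] [UniformSpace Z] [IsUniformAddGroup Z]

theorem exists_addGroupSeminorm_of_mem_uniformity {W : Set (Z × Z)} (hW : W ∈ uniformity Z) :
    ∃ p : AddGroupSeminorm Z, Continuous p ∧ ∀ a b, p (b - a) < 1 → (a, b) ∈ W := by
  rw [uniformity_eq_comap_nhds_zero] at hW
  obtain ⟨V, hV, h⟩ := hW
  obtain ⟨p, hp, hpV⟩ := exists_continuous_addGroupSeminorm hV
  exact ⟨p, hp, fun a b hab => h (hpV _ hab)⟩

theorem addGroupSeminorm_mem_uniformity {p : AddGroupSeminorm Z} (hp : Continuous p) {ε : ℝ}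
    (hε : 0 < ε) : {q : Z × Z | p (q.2 - q.1) < ε} ∈ uniformity Z := by
  rw [uniformity_eq_comap_nhds_zero]
  refine ⟨{z | p z < ε}, ?_, fun q hq => hq⟩
  refine hp.continuousAt.preimage_mem_nhds (Iio_mem_nhds ?_)
  rwa [map_zero]

/-- A net with values in a set of complete closure converges if it is Cauchy for every continuous
group seminorm. -/
theorem exists_tendsto_of_addGroupSeminorm {ι : Type*} {l : Filter ι} [l.NeBot] {u : ι → Z}
    {C : Set Z} (hC : IsComplete C) (hu : ∀ᶠ i in l, u i ∈ C)
    (h : ∀ p : AddGroupSeminorm Z, Continuous p → ∀ ε > 0, ∃ z, ∀ᶠ i in l, p (z - u i) ≤ ε) :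
    ∃ z ∈ C, Tendsto u l (𝓝 z) := by
  refine hC (l.map u) ?_ (le_principal_iff.2 hu)
  refine ⟨inferInstance, fun W hW => ?_⟩
  obtain ⟨p, hp, hpW⟩ := exists_addGroupSeminorm_of_mem_uniformity hW
  obtain ⟨z, hz⟩ := h p hp (1 / 3) (by norm_num)
  rw [prod_map_map_eq, mem_map]
  filter_upwards [hz.prod_mk hz] with q hq
  refine hpW _ _ ?_
  have : u q.2 - u q.1 = (z - u q.1) - (z - u q.2) := by abel
  rw [this]
  linarith [map_sub_le_add p (z - u q.1) (z - u q.2), hq.1, hq.2]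

end UniformGroup

/-! ### Cutoff systems and small sets -/

section SmallSets

set_option linter.unusedSectionVars false

variable {S X Z : Type*} [TopologicalSpace S] [NormedAddCommGroup X] [NormedSpace ℝ X]

/-- `φ` is a `[0, 1]`-valued multiplier of `F` that equals `1` over `κ` and is supported by `β`. -/
structure IsCutoff (K : Set (Set S)) (F : Submodule ℝ (S → X)) (κ β : Set S) (φ : S → ℝ) :
    Prop where
  mem_Icc : ∀ s, φ s ∈ Icc (0 : ℝ) 1
  eq_one : EqualsOver {γ : Set S | IsOpen γ} φ 1 κ
  supportedBy : SupportedBy K φ β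
  const_mem : ∀ x : X, (fun s => φ s • x) ∈ F
  smul_mem : ∀ f ∈ F, (fun s => φ s • f s) ∈ F

/-- A space of bounded continuous functions with enough cutoff functions for the family `K` of
closed sets. -/
structure IsCutoffSystem (K : Set (Set S)) (F : Submodule ℝ (S → X)) : Prop where
  isClosed : ∀ κ ∈ K, IsClosed κ
  empty_mem : ∅ ∈ K
  union_mem : ∀ κ ∈ K, ∀ κ' ∈ K, κ ∪ κ' ∈ K
  inter_mem : ∀ κ ∈ K, ∀ c, IsClosed c → κ ∩ c ∈ K
  continuous : ∀ f ∈ F, Continuous f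
  bounded : ∀ f ∈ F, ∃ C : ℝ, ∀ s, ‖f s‖ ≤ C
  supported : ∀ f ∈ F, SupportedBy K f univ
  exists_cutoff : ∀ κ ∈ K, ∀ β, IsOpen β → κ ⊆ β → ∃ φ : S → ℝ, IsCutoff K F κ β φ

variable {K : Set (Set S)} {F : Submodule ℝ (S → X)}

theorem SupportedBy.mono {f : S → X} {α β : Set S} (hf : SupportedBy K f α) (h : α ⊆ β) :
    SupportedBy K f β := by
  obtain ⟨κ, hκ, hκα, h0⟩ := hf
  exact ⟨κ, hκ, hκα.trans h, h0⟩

theorem SupportedBy.eq_zero {f : S → X} {α : Set S} (hf : SupportedBy K f α) {s : S}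
    (hs : s ∉ α) : f s = 0 := by
  obtain ⟨κ, hκ, hκα, h0⟩ := hf
  exact h0 s fun h => hs (hκα h)

theorem IsCutoffSystem.sdiff_mem (hS : IsCutoffSystem K F) {κ γ : Set S} (hκ : κ ∈ K)
    (hγ : IsOpen γ) : κ \ γ ∈ K := hS.inter_mem κ hκ γᶜ hγ.isClosed_compl

theorem IsCutoffSystem.supportedBy_add (hS : IsCutoffSystem K F) {f g : S → X} {α : Set S}
    (hf : SupportedBy K f α) (hg : SupportedBy K g α) : SupportedBy K (f + g) α := by
  obtain ⟨κ, hκ, hκα, h0⟩ := hf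
  obtain ⟨κ', hκ', hκα', h0'⟩ := hg
  refine ⟨κ ∪ κ', hS.union_mem κ hκ κ' hκ', union_subset hκα hκα', fun s hs => ?_⟩
  simp [h0 s fun h => hs (Or.inl h), h0' s fun h => hs (Or.inr h)]

theorem IsCutoffSystem.supportedBy_sub (hS : IsCutoffSystem K F) {f g : S → X} {α : Set S}
    (hf : SupportedBy K f α) (hg : SupportedBy K g α) : SupportedBy K (f - g) α := by
  obtain ⟨κ, hκ, hκα, h0⟩ := hg
  rw [sub_eq_add_neg]
  exact hS.supportedBy_add hf ⟨κ, hκ, hκα, fun s hs => by simp [h0 s hs]⟩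

theorem IsCutoffSystem.supportedBy_sum (hS : IsCutoffSystem K F) {ι : Type*} (t : Finset ι)
    {f : ι → S → X} {α : Set S} (hf : ∀ i ∈ t, SupportedBy K (f i) α) :
    SupportedBy K (∑ i ∈ t, f i) α := by
  classical
  induction t using Finset.induction_on with
  | empty => exact ⟨∅, hS.empty_mem, empty_subset _, fun s _ => by simp⟩
  | insert i t hi ih =>
    rw [Finset.sum_insert hi]
    exact hS.supportedBy_add (hf i (Finset.mem_insert_self _ _))
      (ih fun j hj => hf j (Finset.mem_insert_of_mem hj))

/-- A function that vanishes on an open set `w` is supported outside `w`. -/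
theorem IsCutoffSystem.supportedBy_of_eq_zero (hS : IsCutoffSystem K F) {f : S → X}
    {α β w : Set S} (hf : SupportedBy K f α) (hw : IsOpen w) (h0 : ∀ s ∈ w, f s = 0)
    (h : α \ w ⊆ β) : SupportedBy K f β := by
  obtain ⟨κ, hκ, hκα, hκ0⟩ := hf
  refine ⟨κ \ w, hS.sdiff_mem hκ hw, (sdiff_subset_sdiff_left hκα).trans h, fun s hs => ?_⟩
  by_cases h1 : s ∈ w
  · exact h0 s h1
  · exact hκ0 s fun h2 => hs ⟨h2, h1⟩

theorem IsCutoff.norm_smul_le {κ β : Set S} {φ : S → ℝ} (hφ : IsCutoff K F κ β φ) (s : S) (x : X) :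
    ‖φ s • x‖ ≤ ‖x‖ := by
  rw [norm_smul, Real.norm_of_nonneg (hφ.mem_Icc s).1]
  exact mul_le_of_le_one_left (norm_nonneg _) (hφ.mem_Icc s).2

theorem IsCutoff.smul_supportedBy {κ β : Set S} {φ : S → ℝ} (hφ : IsCutoff K F κ β φ)
    (f : S → X) : SupportedBy K (fun s => φ s • f s) β := by
  obtain ⟨σ, hσ, hσβ, h0⟩ := hφ.supportedBy
  exact ⟨σ, hσ, hσβ, fun s hs => by simp [h0 s hs]⟩

variable [AddCommGroup Z] [Module ℝ Z]

/-- `α` has an open neighbourhood `γ` such that `ℓ` is `(p, ε)`-small on all functions bounded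
by `r` and supported by `γ`. -/
def SmallOn (K : Set (Set S)) {F : Submodule ℝ (S → X)} (ℓ : F →ₗ[ℝ] Z) (p : AddGroupSeminorm Z)
    (r ε : ℝ) (α : Set S) : Prop :=
  ∃ γ, IsOpen γ ∧ α ⊆ γ ∧ ∀ f : F, (∀ s, ‖(f : S → X) s‖ ≤ r) → SupportedBy K (f : S → X) γ →
    p (ℓ f) ≤ ε

variable {ℓ : F →ₗ[ℝ] Z} {p : AddGroupSeminorm Z} {r ε : ℝ}

theorem SmallOn.mono {α β : Set S} (h : SmallOn K ℓ p r ε β) (hαβ : α ⊆ β) :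
    SmallOn K ℓ p r ε α := by
  obtain ⟨γ, hγ, hβ, H⟩ := h
  exact ⟨γ, hγ, hαβ.trans hβ, H⟩

theorem SmallOn.mono_le {α : Set S} {r' ε' : ℝ} (h : SmallOn K ℓ p r ε α) (hr : r' ≤ r)
    (hε : ε ≤ ε') : SmallOn K ℓ p r' ε' α := by
  obtain ⟨γ, hγ, hα, H⟩ := h
  exact ⟨γ, hγ, hα, fun f hf hfγ => (H f (fun s => (hf s).trans hr) hfγ).trans hε⟩

theorem SmallOn.le {α : Set S} (h : SmallOn K ℓ p r ε α) (f : F)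
    (hf : ∀ s, ‖(f : S → X) s‖ ≤ r) (hfα : SupportedBy K (f : S → X) α) : p (ℓ f) ≤ ε := by
  obtain ⟨γ, hγ, hα, H⟩ := h
  exact H f hf (hfα.mono hα)

theorem smallOn_of_isOpen {α : Set S} (hα : IsOpen α) (h : ∀ f : F, (∀ s, ‖(f : S → X) s‖ ≤ r) →
    SupportedBy K (f : S → X) α → p (ℓ f) ≤ ε) : SmallOn K ℓ p r ε α :=
  ⟨α, hα, Subset.rfl, h⟩

theorem smallOn_empty : SmallOn K ℓ p r 0 ∅ := by
  refine smallOn_of_isOpen isOpen_empty fun f _ hf => ?_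
  have : f = 0 := Subtype.ext (funext fun s => hf.eq_zero (notMem_empty s))
  simp [this]

/-- Split f = φf + (1 - φ)f, where φ is 1 near the part of the support outside δ and is supported by
γ. Then the second summand is supported by δ, and both keep the bound r. -/
theorem IsCutoffSystem.smallOn_union (hS : IsCutoffSystem K F) {α β : Set S} {ε' : ℝ}
    (hα : SmallOn K ℓ p r ε α) (hβ : SmallOn K ℓ p r ε' β) :
    SmallOn K ℓ p r (ε + ε') (α ∪ β) := by
  obtain ⟨γ, hγ, hαγ, H⟩ := hα
  obtain ⟨δ, hδ, hβδ, H'⟩ := hβ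
  refine ⟨γ ∪ δ, hγ.union hδ, union_subset_union hαγ hβδ, fun f hf hfs => ?_⟩
  obtain ⟨κ, hκ, hκs, h0⟩ := hfs
  obtain ⟨φ, hφ⟩ := hS.exists_cutoff (κ \ δ) (hS.sdiff_mem hκ hδ) γ hγ
    (fun s hs => (hκs hs.1).resolve_right hs.2)
  let g : F := ⟨fun s => φ s • (f : S → X) s, hφ.smul_mem f f.2⟩
  have h1 : p (ℓ g) ≤ ε := H g (fun s => (hφ.norm_smul_le s _).trans (hf s))
    (hφ.smul_supportedBy f)
  have h2 : p (ℓ (f - g)) ≤ ε' := by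
    obtain ⟨w, hw, hκw, h1w⟩ := hφ.eq_one
    have hval : ∀ s, ((f - g : F) : S → X) s = (1 - φ s) • (f : S → X) s := fun s => by
      simp [g, sub_smul]
    refine H' _ (fun s => ?_) (hS.supportedBy_of_eq_zero (α := κ) (w := w) ?_ hw ?_ ?_)
    · rw [hval, norm_smul, Real.norm_of_nonneg (by linarith [(hφ.mem_Icc s).2])]
      exact (mul_le_of_le_one_left (norm_nonneg _) (by linarith [(hφ.mem_Icc s).1])).trans (hf s)
    · exact ⟨κ, hκ, Subset.rfl, fun s hs => by rw [hval, h0 s hs, smul_zero]⟩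
    · intro s hs
      rw [hval, h1w s hs, sub_self, zero_smul]
    · intro s hs
      by_contra h
      exact hs.2 (hκw ⟨hs.1, h⟩)
  have h3 : ℓ f = ℓ g + ℓ (f - g) := by rw [← map_add]; congr 1; abel
  rw [h3]
  exact (map_add_le_add p _ _).trans (add_le_add h1 h2)

theorem IsCutoffSystem.smallOn_biUnion (hS : IsCutoffSystem K F) {ι : Type*} (t : Finset ι)
    {α : ι → Set S} {ε : ι → ℝ} (h : ∀ i ∈ t, SmallOn K ℓ p r (ε i) (α i)) :
    SmallOn K ℓ p r (∑ i ∈ t, ε i) (⋃ i ∈ t, α i) := by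
  classical
  induction t using Finset.induction_on with
  | empty => simpa using smallOn_empty
  | insert i t hi ih =>
    rw [Finset.sum_insert hi, Finset.set_biUnion_insert]
    exact hS.smallOn_union (h i (Finset.mem_insert_self _ _))
      (ih fun j hj => h j (Finset.mem_insert_of_mem hj))

variable [UniformSpace Z]

/-- A linear map on bounded functions that is continuous for uniform convergence, tends to zero
along bounded disjointly supported sequences and has relatively complete images of bounded sets. -/
structure IsExhaustive (ℓ : F →ₗ[ℝ] Z) : Prop where
  exists_le : ∀ p : AddGroupSeminorm Z, Continuous p → ∀ ε > 0, ∃ δ > 0, ∀ f : F,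
    (∀ s, ‖(f : S → X) s‖ ≤ δ) → p (ℓ f) ≤ ε
  exhaustive : ∀ p : AddGroupSeminorm Z, Continuous p → ∀ r : ℝ, ∀ ε > 0, ∀ f : ℕ → F,
    (∀ k s, ‖(f k : S → X) s‖ ≤ r) →
    (∀ i j, i < j → ∀ s, (f i : S → X) s = 0 ∨ (f j : S → X) s = 0) → ∃ k, p (ℓ (f k)) ≤ ε
  isComplete : ∀ r : ℝ, IsComplete (closure (ℓ '' {f : F | ∀ s, ‖(f : S → X) s‖ ≤ r}))

/-- Inner regularity of open sets. -/
theorem IsCutoffSystem.exists_inner (hS : IsCutoffSystem K F) (hℓ : IsExhaustive ℓ)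
    (hp : Continuous p) (r : ℝ) (hε : 0 < ε) {γ : Set S} (hγ : IsOpen γ) :
    ∃ κ ∈ K, κ ⊆ γ ∧ SmallOn K ℓ p r ε (γ \ κ) := by
  -- Otherwise every κ leaves a function on γ \ κ with a large image. Adding its support to κ and
  -- repeating gives a bounded, disjointly supported sequence with all images large.
  by_contra! H
  have step : ∀ κ : {κ : Set S // κ ∈ K ∧ κ ⊆ γ}, ∃ f : F, ∃ κ' : {κ : Set S // κ ∈ K ∧ κ ⊆ γ},
      (∀ s, ‖(f : S → X) s‖ ≤ r) ∧ (∀ s ∈ κ.1, (f : S → X) s = 0) ∧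
      (∀ s ∉ κ'.1, (f : S → X) s = 0) ∧ κ.1 ⊆ κ'.1 ∧ ε < p (ℓ f) := by
    rintro ⟨κ, hκ, hκγ⟩
    have h1 := H κ hκ hκγ
    obtain ⟨f, hf, ⟨σ, hσ, hσγ, h0⟩, hpf⟩ : ∃ f : F, (∀ s, ‖(f : S → X) s‖ ≤ r) ∧
        SupportedBy K (f : S → X) (γ \ κ) ∧ ε < p (ℓ f) := by
      by_contra! h
      exact h1 (smallOn_of_isOpen (hγ.sdiff (hS.isClosed κ hκ)) h)
    exact ⟨f, ⟨κ ∪ σ, hS.union_mem κ hκ σ hσ, union_subset hκγ (hσγ.trans sdiff_subset)⟩, hf,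
      fun s hs => h0 s fun h => (hσγ h).2 hs, fun s hs => h0 s fun h => hs (Or.inr h),
      subset_union_left, hpf⟩
  choose f nxt hf h0 h0' hsub hpf using step
  let κ : ℕ → {κ : Set S // κ ∈ K ∧ κ ⊆ γ} := fun n =>
    Nat.rec ⟨∅, hS.empty_mem, empty_subset _⟩ (fun _ κ => nxt κ) n
  have κ_succ : ∀ n, κ (n + 1) = nxt (κ n) := fun n => rfl
  have κ_mono : Monotone fun n => (κ n).1 := monotone_nat_of_le_succ fun n => hsub (κ n)
  obtain ⟨k, hk⟩ := hℓ.exhaustive p hp r ε hε (fun n => f (κ n)) (fun n => hf (κ n))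
    (fun i j hij s => by
      by_cases hs : s ∈ (κ (i + 1)).1
      · exact Or.inr (h0 _ s (κ_mono hij hs))
      · exact Or.inl (h0' _ s hs))
  exact absurd hk (not_le.2 (hpf _))

/-- Outer regularity of members of `K`. -/
theorem IsCutoffSystem.exists_outer (hS : IsCutoffSystem K F) (hℓ : IsExhaustive ℓ)
    (hp : Continuous p) (r : ℝ) (hε : 0 < ε) {κ : Set S} (hκ : κ ∈ K) :
    ∃ β, IsOpen β ∧ κ ⊆ β ∧ SmallOn K ℓ p r ε (β \ κ) := by
  -- Inner regularity of κᶜ suffices: with β = σᶜ, the sets β \ κ and κᶜ \ σ coincide.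
  obtain ⟨σ, hσ, hσκ, h⟩ := hS.exists_inner hℓ hp r hε (hS.isClosed κ hκ).isOpen_compl
  refine ⟨σᶜ, (hS.isClosed σ hσ).isOpen_compl, subset_compl_comm.1 hσκ, h.mono ?_⟩
  exact fun s hs => ⟨hs.2, hs.1⟩

/-- Sets that can be approximated from inside by members of `K` and from outside by open sets. -/
def IsRegularFor (K : Set (Set S)) (ℓ : F →ₗ[ℝ] Z) (α : Set S) : Prop :=
  ∀ p : AddGroupSeminorm Z, Continuous p → ∀ r : ℝ, ∀ ε > 0, ∃ κ ∈ K, ∃ γ, IsOpen γ ∧ κ ⊆ α ∧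
    α ⊆ γ ∧ SmallOn K ℓ p r ε (γ \ κ)

theorem IsCutoffSystem.isRegularFor_of_isOpen (hS : IsCutoffSystem K F) (hℓ : IsExhaustive ℓ)
    {γ : Set S} (hγ : IsOpen γ) : IsRegularFor K ℓ γ := by
  intro p hp r ε hε
  obtain ⟨κ, hκ, hκγ, h⟩ := hS.exists_inner hℓ hp r hε hγ
  exact ⟨κ, hκ, γ, hγ, hκγ, Subset.rfl, h⟩

theorem IsCutoffSystem.isRegularFor_of_mem (hS : IsCutoffSystem K F) (hℓ : IsExhaustive ℓ)
    {κ : Set S} (hκ : κ ∈ K) : IsRegularFor K ℓ κ := by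
  intro p hp r ε hε
  obtain ⟨β, hβ, hκβ, h⟩ := hS.exists_outer hℓ hp r hε hκ
  exact ⟨κ, hκ, β, hβ, Subset.rfl, hκβ, h⟩

/-- The complement of the outer set γ need not lie in K. It is cut down by some σ ∈ K that exhausts
the whole space up to a small set, at the price of a second error ε / 2. -/
theorem IsCutoffSystem.isRegularFor_compl (hS : IsCutoffSystem K F) (hℓ : IsExhaustive ℓ)
    {α : Set S} (hα : IsRegularFor K ℓ α) : IsRegularFor K ℓ αᶜ := by
  intro p hp r ε hε
  obtain ⟨κ, hκ, γ, hγ, hκα, hαγ, h⟩ := hα p hp r (ε / 2) (half_pos hε)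
  obtain ⟨σ, hσ, -, h'⟩ := hS.exists_inner hℓ hp r (half_pos hε) isOpen_univ
  refine ⟨σ \ γ, hS.sdiff_mem hσ hγ, κᶜ, (hS.isClosed κ hκ).isOpen_compl, ?_,
    compl_subset_compl.2 hκα, ((hS.smallOn_union h h').mono ?_).mono_le le_rfl (add_halves ε).le⟩
  · exact fun s hs h => hs.2 (hαγ h)
  · intro s hs
    by_cases h : s ∈ γ
    · exact Or.inl ⟨h, hs.1⟩
    · exact Or.inr ⟨trivial, fun h1 => hs.2 ⟨h1, h⟩⟩

theorem IsCutoffSystem.isRegularFor_union (hS : IsCutoffSystem K F) {α β : Set S}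
    (hα : IsRegularFor K ℓ α) (hβ : IsRegularFor K ℓ β) : IsRegularFor K ℓ (α ∪ β) := by
  intro p hp r ε hε
  obtain ⟨κ, hκ, γ, hγ, hκα, hαγ, h⟩ := hα p hp r (ε / 2) (half_pos hε)
  obtain ⟨κ', hκ', γ', hγ', hκα', hαγ', h'⟩ := hβ p hp r (ε / 2) (half_pos hε)
  refine ⟨κ ∪ κ', hS.union_mem κ hκ κ' hκ', γ ∪ γ', hγ.union hγ', union_subset_union hκα hκα',
    union_subset_union hαγ hαγ', ((hS.smallOn_union h h').mono ?_).mono_le le_rfl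
      (add_halves ε).le⟩
  rintro s ⟨h1 | h1, h2⟩
  · exact Or.inl ⟨h1, fun h => h2 (Or.inl h)⟩
  · exact Or.inr ⟨h1, fun h => h2 (Or.inr h)⟩

theorem IsCutoffSystem.isSetAlgebra (hS : IsCutoffSystem K F) (hℓ : IsExhaustive ℓ) :
    MeasureTheory.IsSetAlgebra {α | IsRegularFor K ℓ α} where
  empty_mem := hS.isRegularFor_of_isOpen hℓ isOpen_empty
  compl_mem := fun _ h => hS.isRegularFor_compl hℓ h
  union_mem := fun _ _ h h' => hS.isRegularFor_union h h'

/-- Disjoint sequences of regular sets contain arbitrarily small members. -/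
theorem IsCutoffSystem.exists_smallOn (hS : IsCutoffSystem K F) (hℓ : IsExhaustive ℓ)
    (hp : Continuous p) (r : ℝ) (hε : 0 < ε) {α : ℕ → Set S}
    (hα : ∀ k, IsRegularFor K ℓ (α k)) (hd : ∀ i j, i < j → Disjoint (α i) (α j)) :
    ∃ k, SmallOn K ℓ p r ε (α k) := by
  by_contra! H
  -- The geometric errors add up to at most ε / 2, leaving ε / 2 for the disjoint open sets β k
  -- below.
  choose κ hκ γ hγ hκα hαγ hsm using fun k =>
    hα k p hp r (ε / 4 * (1 / 2) ^ k) (by positivity)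
  choose φ hφ using fun k =>
    hS.exists_cutoff (κ k) (hκ k) (γ k) (hγ k) ((hκα k).trans (hαγ k))
  choose w hw hκw hw1 using fun k => (hφ k).eq_one
  choose σ hσ hσγ hσ0 using fun k => (hφ k).supportedBy
  have hwσ : ∀ k, w k ⊆ σ k := fun k s hs => by
    by_contra h
    have h1 := hw1 k s hs
    rw [hσ0 k s h] at h1
    exact zero_ne_one h1
  -- Removing the earlier supports makes the β k disjoint, because w j ⊆ σ j.
  let β : ℕ → Set S := fun k => w k \ ⋃ j ∈ Finset.range k, σ j
  have hβ : ∀ k, IsOpen (β k) := fun k =>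
    (hw k).sdiff (isClosed_biUnion_finset fun j _ => hS.isClosed _ (hσ j))
  have key : ∀ k, ∃ f : F, (∀ s, ‖(f : S → X) s‖ ≤ r) ∧ SupportedBy K (f : S → X) (β k) ∧
      ε / 2 < p (ℓ f) := by
    intro k
    by_contra! h
    have h1 : SmallOn K ℓ p r (ε / 2) (β k) := smallOn_of_isOpen (hβ k) h
    have h2 := hS.smallOn_biUnion (Finset.range (k + 1)) fun i _ => hsm i
    have h3 := hS.smallOn_union h1 h2
    refine H k ((h3.mono ?_).mono_le le_rfl ?_)
    -- A point of α k outside β k is either outside κ k, or in σ j ⊆ γ j for some j < k. In the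
    -- latter case it is not in κ j, as α j and α k are disjoint. Thus it lies in some γ j \ κ j
    -- with j ≤ k.
    · intro s hs
      by_cases h4 : s ∈ β k
      · exact Or.inl h4
      · refine Or.inr ?_
        simp only [mem_iUnion, Finset.mem_range]
        by_cases h5 : s ∈ κ k
        · have h6 : s ∈ ⋃ j ∈ Finset.range k, σ j := by
            by_contra h7
            exact h4 ⟨hκw k h5, h7⟩
          simp only [mem_iUnion, Finset.mem_range] at h6
          obtain ⟨j, hj, hsj⟩ := h6
          exact ⟨j, by omega, hσγ j hsj,
            fun h8 => (hd j k hj).le_bot ⟨hκα j h8, hs⟩⟩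
        · exact ⟨k, by omega, hαγ k hs, h5⟩
    · rw [← Finset.mul_sum]
      have := sum_geometric_two_le (k + 1)
      nlinarith
  choose f hf hfs hpf using key
  obtain ⟨k, hk⟩ := hℓ.exhaustive p hp r (ε / 2) (half_pos hε) f hf (fun i j hij s => by
    by_cases h : s ∈ σ i
    · refine Or.inr ((hfs j).eq_zero fun h1 => h1.2 ?_)
      simp only [mem_iUnion, Finset.mem_range]
      exact ⟨i, hij, h⟩
    · exact Or.inl ((hfs i).eq_zero fun h1 => h (hwσ i h1.1)))
  exact absurd hk (not_le.2 (hpf k))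

end SmallSets

/-! ### The set functions generated by an exhaustive functional -/

section GeneratedSetFunction

set_option linter.unusedSectionVars false

variable {S X Z : Type*} [TopologicalSpace S] [NormedAddCommGroup X] [NormedSpace ℝ X]
  [ProperSpace X] [AddCommGroup Z] [Module ℝ Z] [UniformSpace Z] [IsUniformAddGroup Z] [T2Space Z]

theorem closedBall_mem_closedBalancedTotallyBounded {r : ℝ} (hr : 0 ≤ r) :
    Metric.closedBall (0 : X) r ∈ closedBalancedTotallyBounded X :=
  ⟨⟨0, Metric.mem_closedBall_self hr⟩, Metric.isClosed_closedBall, balanced_closedBall_zero,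
    (isCompact_closedBall 0 r).totallyBounded⟩

theorem exists_norm_le_of_mem_closedBalancedTotallyBounded {B : Set X}
    (hB : B ∈ closedBalancedTotallyBounded X) : ∃ r, 0 ≤ r ∧ ∀ x ∈ B, ‖x‖ ≤ r := by
  obtain ⟨r, hr⟩ := hB.2.2.2.isBounded.subset_closedBall 0
  exact ⟨max r 0, le_max_right _ _, fun x hx =>
    (mem_closedBall_zero_iff.1 (hr hx)).trans (le_max_left _ _)⟩

/-- `τ_ℓ` for the open sets and the closed balanced totally bounded sets. -/
noncomputable abbrev genTau (K : Set (Set S)) {F : Submodule ℝ (S → X)} (ℓ : F →ₗ[ℝ] Z)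
    (κ : Set S) (x : X) : Z :=
  tauOf K {γ : Set S | IsOpen γ} (closedBalancedTotallyBounded X) F ℓ κ x

/-- `ξ_ℓ` for the open sets and the closed balanced totally bounded sets. -/
noncomputable abbrev genXi (K : Set (Set S)) {F : Submodule ℝ (S → X)} (ℓ : F →ₗ[ℝ] Z)
    (γ : Set S) (x : X) : Z :=
  xiOf K {γ : Set S | IsOpen γ} (closedBalancedTotallyBounded X) F ℓ γ x

/-- `ν_ℓ` for the open sets and the closed balanced totally bounded sets. -/
noncomputable abbrev genNu (K : Set (Set S)) {F : Submodule ℝ (S → X)} (ℓ : F →ₗ[ℝ] Z)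
    (α : Set S) (x : X) : Z :=
  nuOf K {γ : Set S | IsOpen γ} (closedBalancedTotallyBounded X) F ℓ α x

variable {K : Set (Set S)} {F : Submodule ℝ (S → X)} {ℓ : F →ₗ[ℝ] Z} {p : AddGroupSeminorm Z}
  {r ε : ℝ} {x : X} {κ : Set S}

/-! ### Convergence of the approximants: the set function τ. -/

theorem hasBasis_approxFilter (x : X) (κ : Set S) (A : Set X) :
    (approxFilter K {γ : Set S | IsOpen γ} F x κ A).HasBasis (fun β => IsOpen β ∧ κ ⊆ β)
      (fun β => {f : F | range (f : S → X) ⊆ A ∧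
        EqualsOver {γ : Set S | IsOpen γ} (f : S → X) x κ ∧ SupportedBy K (f : S → X) β}) := by
  refine hasBasis_biInf_principal' ?_ ⟨univ, isOpen_univ, subset_univ _⟩
  rintro β ⟨hβ, hκβ⟩ β' ⟨hβ', hκβ'⟩
  exact ⟨β ∩ β', ⟨IsOpen.inter hβ hβ', subset_inter hκβ hκβ'⟩,
    fun f hf => ⟨hf.1, hf.2.1, hf.2.2.mono inter_subset_left⟩,
    fun f hf => ⟨hf.1, hf.2.1, hf.2.2.mono inter_subset_right⟩⟩

theorem approxFilter_mono {A B : Set X} (h : A ⊆ B) :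
    approxFilter K {γ : Set S | IsOpen γ} F x κ A ≤
      approxFilter K {γ : Set S | IsOpen γ} F x κ B := by
  refine (hasBasis_approxFilter x κ A).le_basis_iff (hasBasis_approxFilter x κ B) |>.2 ?_
  exact fun β hβ => ⟨β, hβ, fun f hf => ⟨hf.1.trans h, hf.2⟩⟩

theorem EqualsOver.smul_const {φ : S → ℝ} (hφ : EqualsOver {γ : Set S | IsOpen γ} φ 1 κ) (x : X) :
    EqualsOver {γ : Set S | IsOpen γ} (fun s => φ s • x) x κ := by
  obtain ⟨w, hw, hκw, h⟩ := hφ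
  exact ⟨w, hw, hκw, fun s hs => by simp [h s hs]⟩

theorem IsCutoffSystem.approxFilter_neBot (hS : IsCutoffSystem K F) (hκ : κ ∈ K) {A : Set X}
    (hA : ∀ t ∈ Icc (0 : ℝ) 1, t • x ∈ A) :
    (approxFilter K {γ : Set S | IsOpen γ} F x κ A).NeBot := by
  refine (hasBasis_approxFilter x κ A).neBot_iff.2 ?_
  rintro β ⟨hβ, hκβ⟩
  obtain ⟨φ, hφ⟩ := hS.exists_cutoff κ hκ β hβ hκβ
  refine ⟨⟨_, hφ.const_mem x⟩, ?_, hφ.eq_one.smul_const x, hφ.smul_supportedBy fun _ => x⟩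
  rintro _ ⟨s, rfl⟩
  exact hA _ (hφ.mem_Icc s)

theorem smul_mem_hull {t : ℝ} (ht : t ∈ Icc (0 : ℝ) 1) :
    t • x ∈ hull (closedBalancedTotallyBounded X) x := by
  rintro B ⟨hB, hx⟩
  exact hB.2.2.1 t (by rw [Real.norm_of_nonneg ht.1]; exact ht.2) (smul_mem_smul_set hx)

/-- Two approximants of `x` over `κ` differ little. -/
theorem IsCutoffSystem.map_sub_le (hS : IsCutoffSystem K F) {β : Set S}
    (h : SmallOn K ℓ p (2 * r) ε (β \ κ)) {f g : F} (hf : ∀ s, ‖(f : S → X) s‖ ≤ r)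
    (hg : ∀ s, ‖(g : S → X) s‖ ≤ r) (hfx : EqualsOver {γ : Set S | IsOpen γ} (f : S → X) x κ)
    (hgx : EqualsOver {γ : Set S | IsOpen γ} (g : S → X) x κ)
    (hfβ : SupportedBy K (f : S → X) β) (hgβ : SupportedBy K (g : S → X) β) :
    p (ℓ f - ℓ g) ≤ ε := by
  rw [← map_sub]
  obtain ⟨w, hw, hκw, h1⟩ := hfx
  obtain ⟨w', hw', hκw', h1'⟩ := hgx
  refine h.le (f - g) (fun s => ?_)
    (hS.supportedBy_of_eq_zero (w := w ∩ w') (hS.supportedBy_sub hfβ hgβ) (IsOpen.inter hw hw')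
      ?_ ?_)
  · exact (norm_sub_le _ _).trans (by linarith [hf s, hg s])
  · intro s hs
    change (f : S → X) s - (g : S → X) s = 0
    rw [h1 s hs.1, h1' s hs.2, sub_self]
  · exact sdiff_subset_sdiff_right (subset_inter hκw hκw')

theorem smul_mem_closedBall (hx : ‖x‖ ≤ r) {t : ℝ} (ht : t ∈ Icc (0 : ℝ) 1) :
    t • x ∈ Metric.closedBall (0 : X) r := by
  rw [mem_closedBall_zero_iff, norm_smul, Real.norm_of_nonneg ht.1]
  exact (mul_le_of_le_one_left (norm_nonneg _) ht.2).trans hx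

theorem norm_le_of_range_subset {f : F} (hf : range (f : S → X) ⊆ Metric.closedBall (0 : X) r)
    (s : S) : ‖(f : S → X) s‖ ≤ r :=
  mem_closedBall_zero_iff.1 (hf ⟨s, rfl⟩)

/-- Outer regularity makes the net Cauchy. The filter for the hull of x, which defines τ, is proper
and finer than the one for any ball containing x, so all of these have the same limit. -/
theorem IsCutoffSystem.tendsto_genTau_closedBall (hS : IsCutoffSystem K F) (hℓ : IsExhaustive ℓ)
    (hκ : κ ∈ K) (hx : ‖x‖ ≤ r) :
    Tendsto ℓ (approxFilter K {γ : Set S | IsOpen γ} F x κ (Metric.closedBall 0 r))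
      (𝓝 (genTau K ℓ κ x)) := by
  have hb := hasBasis_approxFilter (K := K) (F := F) x κ (Metric.closedBall 0 r)
  have := hS.approxFilter_neBot hκ fun t ht => smul_mem_closedBall hx ht
  have := hS.approxFilter_neBot hκ fun t ht => smul_mem_hull (x := x) ht
  obtain ⟨z, -, hz⟩ := exists_tendsto_of_addGroupSeminorm
    (l := approxFilter K {γ : Set S | IsOpen γ} F x κ (Metric.closedBall 0 r)) (u := ℓ)
    (hℓ.isComplete r)
    (by
      filter_upwards [hb.mem_of_mem ⟨isOpen_univ, subset_univ _⟩] with f hf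
      exact subset_closure ⟨f, norm_le_of_range_subset hf.1, rfl⟩)
    (by
      intro p hp ε hε
      obtain ⟨β, hβ, hκβ, h⟩ := hS.exists_outer hℓ hp (2 * r) hε hκ
      have hmem := hb.mem_of_mem ⟨hβ, hκβ⟩
      obtain ⟨g, hg⟩ := Filter.nonempty_of_mem hmem
      refine ⟨ℓ g, ?_⟩
      filter_upwards [hmem] with f hf
      exact hS.map_sub_le h (norm_le_of_range_subset hg.1) (norm_le_of_range_subset hf.1)
        hg.2.1 hf.2.1 hg.2.2 hf.2.2)
  have hr : 0 ≤ r := (norm_nonneg x).trans hx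
  have hsub : hull (closedBalancedTotallyBounded X) x ⊆ Metric.closedBall 0 r :=
    sInter_subset_of_mem ⟨closedBall_mem_closedBalancedTotallyBounded hr,
      mem_closedBall_zero_iff.2 hx⟩
  have : genTau K ℓ κ x = z := (hz.mono_left (approxFilter_mono hsub)).limUnder_eq
  rwa [this]

theorem IsCutoffSystem.tendsto_genTau (hS : IsCutoffSystem K F) (hℓ : IsExhaustive ℓ)
    (hκ : κ ∈ K) {B : Set X} (hB : B ∈ closedBalancedTotallyBounded X) (hx : x ∈ B) :
    Tendsto ℓ (approxFilter K {γ : Set S | IsOpen γ} F x κ B) (𝓝 (genTau K ℓ κ x)) := by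
  obtain ⟨r, -, hr⟩ := exists_norm_le_of_mem_closedBalancedTotallyBounded hB
  exact (hS.tendsto_genTau_closedBall hℓ hκ (hr x hx)).mono_left
    (approxFilter_mono fun y hy => mem_closedBall_zero_iff.2 (hr y hy))

theorem IsCutoffSystem.sub_genTau_le_of_forall (hS : IsCutoffSystem K F) (hℓ : IsExhaustive ℓ)
    (hp : Continuous p) (hκ : κ ∈ K) (hx : ‖x‖ ≤ r) {β : Set S} (hβ : IsOpen β) (hκβ : κ ⊆ β)
    {c : Z} (h : ∀ g : F, (∀ s, ‖(g : S → X) s‖ ≤ r) →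
      EqualsOver {γ : Set S | IsOpen γ} (g : S → X) x κ → SupportedBy K (g : S → X) β →
      p (c - ℓ g) ≤ ε) : p (c - genTau K ℓ κ x) ≤ ε := by
  have := hS.approxFilter_neBot hκ fun t ht => smul_mem_closedBall hx ht
  refine le_of_tendsto ((hp.tendsto _).comp
    ((hS.tendsto_genTau_closedBall hℓ hκ hx).const_sub c)) ?_
  filter_upwards [(hasBasis_approxFilter x κ _).mem_of_mem ⟨hβ, hκβ⟩] with f hf
  exact h f (norm_le_of_range_subset hf.1) hf.2.1 hf.2.2

theorem IsCutoffSystem.genTau_sub_le (hS : IsCutoffSystem K F) (hℓ : IsExhaustive ℓ)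
    (hp : Continuous p) (hκ : κ ∈ K) (hx : ‖x‖ ≤ r) {β : Set S} (hβ : IsOpen β) (hκβ : κ ⊆ β)
    (h : SmallOn K ℓ p (2 * r) ε (β \ κ)) {f : F} (hf : ∀ s, ‖(f : S → X) s‖ ≤ r)
    (hfx : EqualsOver {γ : Set S | IsOpen γ} (f : S → X) x κ)
    (hfβ : SupportedBy K (f : S → X) β) : p (genTau K ℓ κ x - ℓ f) ≤ ε := by
  rw [map_sub_rev]
  exact hS.sub_genTau_le_of_forall hℓ hp hκ hx hβ hκβ fun g hg hgx hgβ =>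
    hS.map_sub_le h hf hg hfx hgx hfβ hgβ

theorem IsCutoffSystem.genTau_mem_closure (hS : IsCutoffSystem K F) (hℓ : IsExhaustive ℓ)
    (hκ : κ ∈ K) (hx : ‖x‖ ≤ r) :
    genTau K ℓ κ x ∈ closure (ℓ '' {f : F | ∀ s, ‖(f : S → X) s‖ ≤ r}) := by
  have := hS.approxFilter_neBot hκ fun t ht => smul_mem_closedBall hx ht
  refine mem_closure_of_tendsto (hS.tendsto_genTau_closedBall hℓ hκ hx) ?_
  filter_upwards [(hasBasis_approxFilter x κ _).mem_of_mem ⟨isOpen_univ, subset_univ _⟩] with f hf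
  exact ⟨f, norm_le_of_range_subset hf.1, rfl⟩

/-- An approximant over the larger set κ' is also one over κ, and τ on κ is close to all of these.
-/
theorem IsCutoffSystem.genTau_sub_genTau_le (hS : IsCutoffSystem K F) (hℓ : IsExhaustive ℓ)
    (hp : Continuous p) (hκ : κ ∈ K) {κ' : Set S} (hκ' : κ' ∈ K) (hx : ‖x‖ ≤ r) {γ : Set S}
    (hγ : IsOpen γ) (hκκ' : κ ⊆ κ') (hκγ : κ' ⊆ γ) (h : SmallOn K ℓ p (2 * r) ε (γ \ κ)) :
    p (genTau K ℓ κ x - genTau K ℓ κ' x) ≤ ε := by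
  refine hS.sub_genTau_le_of_forall hℓ hp hκ' hx hγ hκγ fun g hg hgx hgγ => ?_
  refine hS.genTau_sub_le hℓ hp hκ hx hγ (hκκ'.trans hκγ) h hg ?_ hgγ
  obtain ⟨w, hw, hw', h1⟩ := hgx
  exact ⟨w, hw, hκκ'.trans hw', h1⟩

theorem IsCutoffSystem.genTau_zero (hS : IsCutoffSystem K F) (hℓ : IsExhaustive ℓ)
    (hκ : κ ∈ K) : genTau K ℓ κ (0 : X) = 0 := by
  refine eq_of_addGroupSeminorm fun p hp ε hε => ?_
  obtain ⟨β, hβ, hκβ, h⟩ := hS.exists_outer hℓ hp (2 * 0) hε hκ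
  have := hS.genTau_sub_le (x := 0) hℓ hp hκ (by simp) hβ hκβ h (f := 0) (fun s => by simp)
    ⟨univ, isOpen_univ, subset_univ _, fun s _ => rfl⟩
    ⟨∅, hS.empty_mem, empty_subset _, fun s _ => rfl⟩
  simpa using this

/-! ### The limits ξ and ν. -/

theorem IsCutoffSystem.neBot_atTop_inner (hS : IsCutoffSystem K F) (γ : Set S) :
    (atTop : Filter {κ : Set S // κ ∈ K ∧ κ ⊆ γ}).NeBot := by
  have : Nonempty {κ : Set S // κ ∈ K ∧ κ ⊆ γ} := ⟨⟨∅, hS.empty_mem, empty_subset _⟩⟩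
  have : IsDirectedOrder {κ : Set S // κ ∈ K ∧ κ ⊆ γ} :=
    ⟨fun a b => ⟨⟨a.1 ∪ b.1, hS.union_mem _ a.2.1 _ b.2.1, union_subset a.2.2 b.2.2⟩,
      (subset_union_left : a.1 ⊆ a.1 ∪ b.1), (subset_union_right : b.1 ⊆ a.1 ∪ b.1)⟩⟩
  exact atTop_neBot

theorem neBot_atBot_outer (α : Set S) :
    (atBot : Filter {γ : Set S // γ ∈ {γ : Set S | IsOpen γ} ∧ α ⊆ γ}).NeBot := by
  have : Nonempty {γ : Set S // γ ∈ {γ : Set S | IsOpen γ} ∧ α ⊆ γ} :=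
    ⟨⟨univ, isOpen_univ, subset_univ _⟩⟩
  have : IsCodirectedOrder {γ : Set S // γ ∈ {γ : Set S | IsOpen γ} ∧ α ⊆ γ} :=
    ⟨fun a b => ⟨⟨a.1 ∩ b.1, IsOpen.inter a.2.1 b.2.1, subset_inter a.2.2 b.2.2⟩,
      (inter_subset_left : a.1 ∩ b.1 ⊆ a.1), (inter_subset_right : a.1 ∩ b.1 ⊆ b.1)⟩⟩
  exact atBot_neBot

theorem IsCutoffSystem.tendsto_genXi (hS : IsCutoffSystem K F) (hℓ : IsExhaustive ℓ)
    {γ : Set S} (hγ : IsOpen γ) (x : X) :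
    Tendsto (fun κ : {κ : Set S // κ ∈ K ∧ κ ⊆ γ} => genTau K ℓ κ x) atTop
      (𝓝 (genXi K ℓ γ x)) := by
  have := hS.neBot_atTop_inner γ
  obtain ⟨z, -, hz⟩ := exists_tendsto_of_addGroupSeminorm
    (l := (atTop : Filter {κ : Set S // κ ∈ K ∧ κ ⊆ γ}))
    (u := fun κ : {κ : Set S // κ ∈ K ∧ κ ⊆ γ} => genTau K ℓ κ x) (hℓ.isComplete ‖x‖)
    (Eventually.of_forall fun κ => hS.genTau_mem_closure hℓ κ.2.1 le_rfl)
    (by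
      intro p hp ε hε
      obtain ⟨κ, hκ, hκγ, h⟩ := hS.exists_inner hℓ hp (2 * ‖x‖) hε hγ
      refine ⟨genTau K ℓ κ x, ?_⟩
      filter_upwards [eventually_ge_atTop ⟨κ, hκ, hκγ⟩] with κ' hκ'
      exact hS.genTau_sub_genTau_le hℓ hp hκ κ'.2.1 le_rfl hγ hκ' κ'.2.2 h)
  have : genXi K ℓ γ x = z := hz.limUnder_eq
  rwa [this]

theorem IsCutoffSystem.genXi_sub_genTau_le (hS : IsCutoffSystem K F) (hℓ : IsExhaustive ℓ)
    (hp : Continuous p) (hκ : κ ∈ K) (hx : ‖x‖ ≤ r) {γ : Set S} (hγ : IsOpen γ) (hκγ : κ ⊆ γ)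
    (h : SmallOn K ℓ p (2 * r) ε (γ \ κ)) : p (genXi K ℓ γ x - genTau K ℓ κ x) ≤ ε := by
  have := hS.neBot_atTop_inner γ
  refine le_of_tendsto ((hp.tendsto _).comp
    ((hS.tendsto_genXi hℓ hγ x).sub_const (genTau K ℓ κ x))) ?_
  filter_upwards [eventually_ge_atTop ⟨κ, hκ, hκγ⟩] with κ' hκ'
  change p (genTau K ℓ κ' x - genTau K ℓ κ x) ≤ ε
  rw [map_sub_rev]
  exact hS.genTau_sub_genTau_le hℓ hp hκ κ'.2.1 hx hγ hκ' κ'.2.2 h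

theorem IsCutoffSystem.genXi_mem_closure (hS : IsCutoffSystem K F) (hℓ : IsExhaustive ℓ)
    {γ : Set S} (hγ : IsOpen γ) (hx : ‖x‖ ≤ r) :
    genXi K ℓ γ x ∈ closure (ℓ '' {f : F | ∀ s, ‖(f : S → X) s‖ ≤ r}) := by
  have := hS.neBot_atTop_inner γ
  exact isClosed_closure.mem_of_tendsto (hS.tendsto_genXi hℓ hγ x)
    (Eventually.of_forall fun κ => hS.genTau_mem_closure hℓ κ.2.1 hx)

/-- A single κ inside γ' serves both sets: γ \ κ contributes 2ε and γ' \ κ contributes ε. -/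
theorem IsCutoffSystem.genXi_sub_genXi_le (hS : IsCutoffSystem K F) (hℓ : IsExhaustive ℓ)
    (hp : Continuous p) (hε : 0 < ε) (hx : ‖x‖ ≤ r) {γ γ' : Set S} (hγ : IsOpen γ)
    (hγ' : IsOpen γ') (hγγ' : γ' ⊆ γ) (h : SmallOn K ℓ p (2 * r) ε (γ \ γ')) :
    p (genXi K ℓ γ x - genXi K ℓ γ' x) ≤ 3 * ε := by
  obtain ⟨κ, hκ, hκγ, h'⟩ := hS.exists_inner hℓ hp (2 * r) hε hγ'
  have h1 : SmallOn K ℓ p (2 * r) (ε + ε) (γ \ κ) := (hS.smallOn_union h h').mono fun s hs => by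
    by_cases h : s ∈ γ'
    · exact Or.inr ⟨h, hs.2⟩
    · exact Or.inl ⟨hs.1, h⟩
  have h2 := hS.genXi_sub_genTau_le hℓ hp hκ hx hγ (hκγ.trans hγγ') h1
  have h3 := hS.genXi_sub_genTau_le hℓ hp hκ hx hγ' hκγ h'
  have h4 := map_sub_le_add p (genXi K ℓ γ x - genTau K ℓ κ x) (genXi K ℓ γ' x - genTau K ℓ κ x)
  rw [sub_sub_sub_cancel_right] at h4
  linarith

/-- This is the Cauchy property behind ν, for arbitrary α. If it failed, a decreasing sequence of
open sets would have jumps of ξ larger than ε. The successive differences are disjoint regular sets,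
so one of them is small for ε / 3, which bounds its jump by 3 · (ε / 3). -/
theorem IsCutoffSystem.exists_genXi_sub_genXi_le (hS : IsCutoffSystem K F) (hℓ : IsExhaustive ℓ)
    (hp : Continuous p) (hε : 0 < ε) (α : Set S) (x : X) :
    ∃ γ, IsOpen γ ∧ α ⊆ γ ∧ ∀ γ', IsOpen γ' → α ⊆ γ' → γ' ⊆ γ →
      p (genXi K ℓ γ x - genXi K ℓ γ' x) ≤ ε := by
  by_contra! H
  have step : ∀ γ : {γ : Set S // IsOpen γ ∧ α ⊆ γ}, ∃ γ' : {γ : Set S // IsOpen γ ∧ α ⊆ γ},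
      γ' ≤ γ ∧ ε < p (genXi K ℓ γ x - genXi K ℓ γ' x) := by
    rintro ⟨γ, hγ, hαγ⟩
    obtain ⟨γ', hγ', hαγ', hle, h⟩ := H γ hγ hαγ
    exact ⟨⟨γ', hγ', hαγ'⟩, hle, h⟩
  choose nxt nxt_le hnxt using step
  obtain ⟨γ, γ_succ⟩ : ∃ γ : ℕ → {γ : Set S // IsOpen γ ∧ α ⊆ γ}, ∀ n, γ (n + 1) = nxt (γ n) :=
    ⟨fun n => Nat.rec ⟨univ, isOpen_univ, subset_univ _⟩ (fun _ γ => nxt γ) n, fun _ => rfl⟩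
  have γ_anti : Antitone γ := antitone_nat_of_succ_le fun n => (γ_succ n).le.trans (nxt_le (γ n))
  have hreg : ∀ k, IsRegularFor K ℓ ((γ k).1 \ (γ (k + 1)).1) := fun k =>
    (hS.isSetAlgebra hℓ).sdiff_mem (hS.isRegularFor_of_isOpen hℓ (γ k).2.1)
      (hS.isRegularFor_of_isOpen hℓ (γ (k + 1)).2.1)
  obtain ⟨k, hk⟩ := hS.exists_smallOn hℓ hp (2 * ‖x‖) (by positivity : 0 < ε / 3) hreg
    (fun i j hij => disjoint_left.2 fun s hs hs' =>
      hs.2 ((γ_anti (Nat.succ_le_of_lt hij) : (γ j).1 ⊆ (γ (i + 1)).1) hs'.1))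
  have h1 := hS.genXi_sub_genXi_le hℓ hp (by positivity) le_rfl (γ k).2.1 (γ (k + 1)).2.1
    (γ_anti (Nat.le_succ k)) hk
  have h2 := hnxt (γ k)
  rw [← γ_succ] at h2
  linarith

theorem IsCutoffSystem.tendsto_genNu (hS : IsCutoffSystem K F) (hℓ : IsExhaustive ℓ)
    (α : Set S) (x : X) :
    Tendsto (fun γ : {γ : Set S // γ ∈ {γ : Set S | IsOpen γ} ∧ α ⊆ γ} => genXi K ℓ γ x) atBot
      (𝓝 (genNu K ℓ α x)) := by
  have := neBot_atBot_outer α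
  obtain ⟨z, -, hz⟩ := exists_tendsto_of_addGroupSeminorm
    (l := (atBot : Filter {γ : Set S // γ ∈ {γ : Set S | IsOpen γ} ∧ α ⊆ γ}))
    (u := fun γ : {γ : Set S // γ ∈ {γ : Set S | IsOpen γ} ∧ α ⊆ γ} => genXi K ℓ γ x)
    (hℓ.isComplete ‖x‖)
    (Eventually.of_forall fun γ => hS.genXi_mem_closure hℓ γ.2.1 le_rfl)
    (by
      intro p hp ε hε
      obtain ⟨γ, hγ, hαγ, h⟩ := hS.exists_genXi_sub_genXi_le hℓ hp hε α x
      refine ⟨genXi K ℓ γ x, ?_⟩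
      filter_upwards [eventually_le_atBot ⟨γ, hγ, hαγ⟩] with γ' hγ'
      exact h γ' γ'.2.1 γ'.2.2 hγ')
  have : genNu K ℓ α x = z := hz.limUnder_eq
  rwa [this]

/-! ### Comparison and additivity of τ, ξ and ν. -/

theorem IsCutoffSystem.genNu_sub_genTau_le (hS : IsCutoffSystem K F) (hℓ : IsExhaustive ℓ)
    (hp : Continuous p) (hκ : κ ∈ K) (hx : ‖x‖ ≤ r) {α γ : Set S} (hγ : IsOpen γ) (hκα : κ ⊆ α)
    (hαγ : α ⊆ γ) (h : SmallOn K ℓ p (2 * r) ε (γ \ κ)) :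
    p (genNu K ℓ α x - genTau K ℓ κ x) ≤ ε := by
  have := neBot_atBot_outer α
  refine le_of_tendsto ((hp.tendsto _).comp
    ((hS.tendsto_genNu hℓ α x).sub_const (genTau K ℓ κ x))) ?_
  filter_upwards [eventually_le_atBot ⟨γ, hγ, hαγ⟩] with γ' hγ'
  exact hS.genXi_sub_genTau_le hℓ hp hκ hx γ'.2.1 (hκα.trans γ'.2.2)
    (h.mono (sdiff_subset_sdiff_left hγ'))

theorem IsCutoffSystem.genNu_eq_genTau (hS : IsCutoffSystem K F) (hℓ : IsExhaustive ℓ)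
    (hκ : κ ∈ K) (x : X) : genNu K ℓ κ x = genTau K ℓ κ x :=
  eq_of_addGroupSeminorm fun p hp ε hε => by
    obtain ⟨β, hβ, hκβ, h⟩ := hS.exists_outer hℓ hp (2 * ‖x‖) hε hκ
    exact hS.genNu_sub_genTau_le hℓ hp hκ le_rfl hβ Subset.rfl hκβ h

theorem IsCutoffSystem.genNu_eq_genXi (hS : IsCutoffSystem K F) (hℓ : IsExhaustive ℓ)
    {γ : Set S} (hγ : IsOpen γ) (x : X) : genNu K ℓ γ x = genXi K ℓ γ x := by
  refine eq_of_addGroupSeminorm fun p hp ε hε => ?_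
  obtain ⟨κ, hκ, hκγ, h⟩ := hS.exists_inner hℓ hp (2 * ‖x‖) (half_pos hε) hγ
  have h1 := hS.genNu_sub_genTau_le hℓ hp hκ le_rfl hγ hκγ Subset.rfl h
  have h2 := hS.genXi_sub_genTau_le hℓ hp hκ le_rfl hγ hκγ h
  have h3 := map_sub_le_add p (genNu K ℓ γ x - genTau K ℓ κ x) (genXi K ℓ γ x - genTau K ℓ κ x)
  rw [sub_sub_sub_cancel_right] at h3
  linarith

/-- If the cutoff for each set vanishes near the other, the sum of the two approximants is an
approximant over the union. -/
theorem IsCutoffSystem.genTau_union (hS : IsCutoffSystem K F) (hℓ : IsExhaustive ℓ)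
    (hκ : κ ∈ K) {κ' : Set S} (hκ' : κ' ∈ K) (hd : Disjoint κ κ') (x : X) :
    genTau K ℓ (κ ∪ κ') x = genTau K ℓ κ x + genTau K ℓ κ' x := by
  refine eq_of_addGroupSeminorm fun p hp ε hε => ?_
  have hε3 : 0 < ε / 3 := by positivity
  -- The two cutoffs may overlap away from κ and κ', so their sum is only bounded by 2.
  set R := 2 * ‖x‖
  have hR : ‖x‖ ≤ R := by have := norm_nonneg x; simp only [R]; linarith
  have hU := hS.union_mem κ hκ κ' hκ'
  obtain ⟨β, hβ, hκβ, h⟩ := hS.exists_outer hℓ hp (2 * R) hε3 hκ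
  obtain ⟨β', hβ', hκβ', h'⟩ := hS.exists_outer hℓ hp (2 * R) hε3 hκ'
  obtain ⟨δ, hδ, hκδ, hsm⟩ := hS.exists_outer hℓ hp (2 * R) hε3 hU
  have key : ∀ {κ κ' β : Set S}, κ ∈ K → κ' ∈ K → Disjoint κ κ' → IsOpen β → κ ⊆ β → κ ⊆ δ →
      SmallOn K ℓ p (2 * R) (ε / 3) (β \ κ) → ∃ φ : S → ℝ, ∃ hφ : ∀ x : X, (fun s => φ s • x) ∈ F,
        (∀ s, φ s ∈ Icc (0 : ℝ) 1) ∧ EqualsOver {γ : Set S | IsOpen γ} φ 1 κ ∧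
        EqualsOver {γ : Set S | IsOpen γ} φ 0 κ' ∧ SupportedBy K (fun s => φ s • x) δ ∧
        p (genTau K ℓ κ x - ℓ ⟨_, hφ x⟩) ≤ ε / 3 := by
    intro κ κ' β hκ hκ' hd hβ hκβ hκδ hsm'
    obtain ⟨φ, hφ⟩ := hS.exists_cutoff κ hκ (β ∩ δ ∩ κ'ᶜ)
      ((hβ.inter hδ).inter (hS.isClosed κ' hκ').isOpen_compl)
      (subset_inter (subset_inter hκβ hκδ) (disjoint_left.1 hd))
    obtain ⟨σ, hσ, hσs, h0⟩ := hφ.supportedBy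
    refine ⟨φ, hφ.const_mem, hφ.mem_Icc, hφ.eq_one,
      ⟨σᶜ, (hS.isClosed σ hσ).isOpen_compl, fun s hs hsσ => (hσs hsσ).2 hs, h0⟩,
      (hφ.smul_supportedBy fun _ => x).mono fun s hs => hs.1.2,
      hS.genTau_sub_le hℓ hp hκ hR hβ hκβ hsm' (fun s => (hφ.norm_smul_le s x).trans hR)
        (hφ.eq_one.smul_const x) ((hφ.smul_supportedBy fun _ => x).mono fun s hs => hs.1.1)⟩
  obtain ⟨φ, hφF, hφ, hφ1, hφ0, hφδ, hpφ⟩ :=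
    key hκ hκ' hd hβ hκβ (subset_union_left.trans hκδ) h
  obtain ⟨ψ, hψF, hψ, hψ1, hψ0, hψδ, hpψ⟩ :=
    key hκ' hκ hd.symm hβ' hκβ' (subset_union_right.trans hκδ) h'
  have h3 : p (genTau K ℓ (κ ∪ κ') x - ℓ (⟨_, hφF x⟩ + ⟨_, hψF x⟩)) ≤ ε / 3 := by
    refine hS.genTau_sub_le hℓ hp hU hR hδ hκδ hsm (fun s => ?_) ?_
      (hS.supportedBy_add hφδ hψδ)
    · change ‖φ s • x + ψ s • x‖ ≤ R
      rw [← add_smul, norm_smul, Real.norm_of_nonneg (add_nonneg (hφ s).1 (hψ s).1)]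
      exact mul_le_mul_of_nonneg_right (by linarith [(hφ s).2, (hψ s).2]) (norm_nonneg _)
    · obtain ⟨w, hw, hκw, hw1⟩ := hφ1
      obtain ⟨w₀, hw₀, hκw₀, hw0⟩ := hφ0
      obtain ⟨v, hv, hκv, hv1⟩ := hψ1
      obtain ⟨v₀, hv₀, hκv₀, hv0⟩ := hψ0
      refine ⟨w ∩ v₀ ∪ v ∩ w₀, (IsOpen.inter hw hv₀).union (IsOpen.inter hv hw₀),
        union_subset_union (subset_inter hκw hκv₀) (subset_inter hκv hκw₀), ?_⟩
      rintro s (hs | hs)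
      · change φ s • x + ψ s • x = x
        rw [hw1 s hs.1, hv0 s hs.2, one_smul, zero_smul, add_zero]
      · change φ s • x + ψ s • x = x
        rw [hv1 s hs.1, hw0 s hs.2, one_smul, zero_smul, zero_add]
  rw [map_add] at h3
  have h4 := map_sub_le_add p (genTau K ℓ (κ ∪ κ') x - (ℓ ⟨_, hφF x⟩ + ℓ ⟨_, hψF x⟩))
    ((genTau K ℓ κ x - ℓ ⟨_, hφF x⟩) + (genTau K ℓ κ' x - ℓ ⟨_, hψF x⟩))
  have h5 := map_add_le_add p (genTau K ℓ κ x - ℓ ⟨_, hφF x⟩) (genTau K ℓ κ' x - ℓ ⟨_, hψF x⟩)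
  have h6 : genTau K ℓ (κ ∪ κ') x - (genTau K ℓ κ x + genTau K ℓ κ' x) =
      (genTau K ℓ (κ ∪ κ') x - (ℓ ⟨_, hφF x⟩ + ℓ ⟨_, hψF x⟩)) -
    ((genTau K ℓ κ x - ℓ ⟨_, hφF x⟩) + (genTau K ℓ κ' x - ℓ ⟨_, hψF x⟩)) := by abel
  rw [h6]
  linarith

/-- Inner approximation reduces this to additivity of τ on K, with errors ε / 4 for each part and ε
/ 2 for the union. -/
theorem IsCutoffSystem.genNu_union (hS : IsCutoffSystem K F) (hℓ : IsExhaustive ℓ)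
    {α β : Set S} (hα : IsRegularFor K ℓ α) (hβ : IsRegularFor K ℓ β) (hd : Disjoint α β) (x : X) :
    genNu K ℓ (α ∪ β) x = genNu K ℓ α x + genNu K ℓ β x := by
  refine eq_of_addGroupSeminorm fun p hp ε hε => ?_
  have hε4 : 0 < ε / 4 := by positivity
  obtain ⟨κ, hκ, γ, hγ, hκα, hαγ, h⟩ := hα p hp (2 * ‖x‖) _ hε4
  obtain ⟨κ', hκ', γ', hγ', hκβ, hβγ, h'⟩ := hβ p hp (2 * ‖x‖) _ hε4
  have h1 := hS.genNu_sub_genTau_le hℓ hp hκ le_rfl hγ hκα hαγ h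
  have h2 := hS.genNu_sub_genTau_le hℓ hp hκ' le_rfl hγ' hκβ hβγ h'
  have h3 := hS.genNu_sub_genTau_le hℓ hp (hS.union_mem κ hκ κ' hκ') (le_refl ‖x‖)
    (hγ.union hγ') (union_subset_union hκα hκβ) (union_subset_union hαγ hβγ)
    ((hS.smallOn_union h h').mono (by
      rintro s ⟨h1 | h1, h2⟩
      · exact Or.inl ⟨h1, fun h => h2 (Or.inl h)⟩
      · exact Or.inr ⟨h1, fun h => h2 (Or.inr h)⟩))
  rw [hS.genTau_union hℓ hκ hκ' (hd.mono hκα hκβ)] at h3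
  have h4 := map_sub_le_add p (genNu K ℓ (α ∪ β) x - (genTau K ℓ κ x + genTau K ℓ κ' x))
    ((genNu K ℓ α x - genTau K ℓ κ x) + (genNu K ℓ β x - genTau K ℓ κ' x))
  have h5 := map_add_le_add p (genNu K ℓ α x - genTau K ℓ κ x) (genNu K ℓ β x - genTau K ℓ κ' x)
  have h6 : genNu K ℓ (α ∪ β) x - (genNu K ℓ α x + genNu K ℓ β x) =
      (genNu K ℓ (α ∪ β) x - (genTau K ℓ κ x + genTau K ℓ κ' x)) -
    ((genNu K ℓ α x - genTau K ℓ κ x) + (genNu K ℓ β x - genTau K ℓ κ' x)) := by abel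
  rw [h6]
  linarith

end GeneratedSetFunction

/-! ### Riemann sums -/

/-- A finite cover by members of an algebra of sets has a finite disjoint refinement. -/
theorem MeasureTheory.IsSetAlgebra.exists_disjoint_refinement {S : Type*} {𝒜 : Set (Set S)}
    (h𝒜 : MeasureTheory.IsSetAlgebra 𝒜) (C : Finset (Set S)) (hC : ∀ c ∈ C, c ∈ 𝒜) :
    ∃ Q : Finset (Set S), (∀ q ∈ Q, q ∈ 𝒜) ∧ (Q : Set (Set S)).PairwiseDisjoint id ∧
      ⋃₀ (Q : Set (Set S)) = ⋃₀ (C : Set (Set S)) ∧ ∀ q ∈ Q, ∃ c ∈ C, q ⊆ c := by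
  classical
  induction C using Finset.induction_on with
  | empty => exact ⟨∅, by simp, by simp, rfl, by simp⟩
  | insert c C hc ih =>
    obtain ⟨Q, hQ, hd, hU, hsub⟩ := ih fun c' hc' => hC c' (Finset.mem_insert_of_mem hc')
    have hUmem : ⋃₀ (Q : Set (Set S)) ∈ 𝒜 := by
      rw [sUnion_eq_biUnion]
      exact h𝒜.biUnion_mem Q hQ
    refine ⟨insert (c \ ⋃₀ (Q : Set (Set S))) Q, ?_, ?_, ?_, ?_⟩
    · intro q hq
      rcases Finset.mem_insert.1 hq with rfl | hq
      · exact h𝒜.sdiff_mem (hC c (Finset.mem_insert_self _ _)) hUmem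
      · exact hQ q hq
    · rw [Finset.coe_insert]
      refine hd.insert fun q hq _ => ?_
      exact disjoint_left.2 fun s hs hsq => hs.2 ⟨q, hq, hsq⟩
    · rw [Finset.coe_insert, Finset.coe_insert, sUnion_insert, sUnion_insert, sdiff_union_self,
        hU]
    · intro q hq
      rcases Finset.mem_insert.1 hq with rfl | hq
      · exact ⟨c, Finset.mem_insert_self _ _, sdiff_subset⟩
      · obtain ⟨c', hc', h⟩ := hsub q hq
        exact ⟨c', Finset.mem_insert_of_mem hc', h⟩

section RiemannSums

set_option linter.unusedSectionVars false

theorem forall_eq_zero_or_exists_of_disjoint {ι S : Type*} {R : Finset ι} {φ : ι → S → ℝ}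
    (hd : ∀ ρ ∈ R, ∀ ρ' ∈ R, ρ ≠ ρ' → ∀ s, φ ρ s = 0 ∨ φ ρ' s = 0) (s : S) :
    (∀ ρ ∈ R, φ ρ s = 0) ∨ ∃ ρ ∈ R, φ ρ s ≠ 0 ∧ ∀ ρ' ∈ R, ρ' ≠ ρ → φ ρ' s = 0 := by
  by_cases h : ∀ ρ ∈ R, φ ρ s = 0
  · exact Or.inl h
  · push Not at h
    obtain ⟨ρ, hρ, h0⟩ := h
    exact Or.inr ⟨ρ, hρ, h0, fun ρ' hρ' hne => (hd ρ' hρ' ρ hρ hne s).resolve_right h0⟩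

variable {S X Z : Type*} [TopologicalSpace S] [NormedAddCommGroup X] [NormedSpace ℝ X]

/-- At each point at most one term survives, so the bound does not grow with the number of terms. -/
theorem norm_sum_smul_le_of_disjoint {ι : Type*} {R : Finset ι} {φ : ι → S → ℝ}
    (hd : ∀ ρ ∈ R, ∀ ρ' ∈ R, ρ ≠ ρ' → ∀ s, φ ρ s = 0 ∨ φ ρ' s = 0)
    (hφ : ∀ ρ ∈ R, ∀ s, φ ρ s ∈ Icc (0 : ℝ) 1) {u : ι → X} {C : ℝ} (hC : 0 ≤ C) (s : S)
    (hu : ∀ ρ ∈ R, φ ρ s ≠ 0 → ‖u ρ‖ ≤ C) : ‖∑ ρ ∈ R, φ ρ s • u ρ‖ ≤ C := by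
  rcases forall_eq_zero_or_exists_of_disjoint hd s with h | ⟨ρ, hρ, h0, h⟩
  · rw [Finset.sum_eq_zero fun ρ hρ => by rw [h ρ hρ, zero_smul], norm_zero]
    exact hC
  · rw [Finset.sum_eq_single ρ (fun ρ' hρ' hne => by rw [h ρ' hρ' hne, zero_smul])
      (fun h => absurd hρ h), norm_smul, Real.norm_of_nonneg (hφ ρ hρ s).1]
    exact (mul_le_of_le_one_left (norm_nonneg _) (hφ ρ hρ s).2).trans (hu ρ hρ h0)

variable [ProperSpace X] [AddCommGroup Z] [Module ℝ Z] [UniformSpace Z] [IsUniformAddGroup Z]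
  [T2Space Z] {K : Set (Set S)} {F : Submodule ℝ (S → X)} {ℓ : F →ₗ[ℝ] Z}
  {p : AddGroupSeminorm Z} {r ε : ℝ}

/-- Finitely many disjoint regular sets are approximated by cutoff functions with disjoint
supports. -/
theorem IsCutoffSystem.exists_disjoint_cutoffs (hS : IsCutoffSystem K F) (hℓ : IsExhaustive ℓ)
    (hp : Continuous p) (hr : 0 ≤ r) (hε : 0 < ε) (R : Finset (Set S))
    (hR : ∀ ρ ∈ R, IsRegularFor K ℓ ρ) (hd : (R : Set (Set S)).PairwiseDisjoint id)
    {O : Set S → Set S} (hO : ∀ ρ ∈ R, IsOpen (O ρ)) (hRO : ∀ ρ ∈ R, ρ ⊆ O ρ) :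
    ∃ (κ : Set S → Set S) (φ : Set S → S → ℝ), (∀ ρ ∈ R, κ ρ ⊆ ρ) ∧
      (∀ ρ ∈ R, SmallOn K ℓ p r ε (ρ \ κ ρ)) ∧ (∀ ρ ∈ R, IsCutoff K F (κ ρ) (O ρ) (φ ρ)) ∧
      (∀ ρ ∈ R, ∀ (x : X) (hx : (fun s => φ ρ s • x) ∈ F), ‖x‖ ≤ r →
        p (genNu K ℓ ρ x - ℓ ⟨_, hx⟩) ≤ ε) ∧
      ∀ ρ ∈ R, ∀ ρ' ∈ R, ρ ≠ ρ' → ∀ s, φ ρ s = 0 ∨ φ ρ' s = 0 := by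
  classical
  choose! κ hκ γ hγ hκρ hργ hsm using fun ρ (hρ : ρ ∈ R) => hR ρ hρ p hp (2 * r) (ε / 2)
    (half_pos hε)
  have hcompl : ∀ ρ ∈ R, IsOpen (⋃ ρ' ∈ R.erase ρ, κ ρ')ᶜ := fun ρ _ =>
    (isClosed_biUnion_finset fun ρ' hρ' =>
      hS.isClosed _ (hκ ρ' (Finset.mem_of_mem_erase hρ'))).isOpen_compl
  -- A preliminary round of cutoffs separates the κ ρ: ψ ρ is 1 on w ρ and its support σ ρ misses
  -- the other κ ρ'. Removing the other σ ρ' from w ρ leaves disjoint open neighbourhoods.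
  choose! ψ hψ using fun ρ (hρ : ρ ∈ R) => hS.exists_cutoff (κ ρ) (hκ ρ hρ) _ (hcompl ρ hρ)
    (by
      intro s hs h
      simp only [mem_iUnion] at h
      obtain ⟨ρ', hρ', hs'⟩ := h
      have hρ'R := Finset.mem_of_mem_erase hρ'
      exact (hd hρ'R hρ (Finset.ne_of_mem_erase hρ')).le_bot ⟨hκρ _ hρ'R hs', hκρ _ hρ hs⟩)
  choose! w hw hκw hw1 using fun ρ (hρ : ρ ∈ R) => (hψ ρ hρ).eq_one
  choose! σ hσ hσκ hσ0 using fun ρ (hρ : ρ ∈ R) => (hψ ρ hρ).supportedBy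
  have hwσ : ∀ ρ ∈ R, w ρ ⊆ σ ρ := fun ρ hρ s hs => by
    by_contra h
    have h1 := hw1 ρ hρ s hs
    rw [hσ0 ρ hρ s h] at h1
    exact zero_ne_one h1
  let β : Set S → Set S := fun ρ => w ρ \ ⋃ ρ' ∈ R.erase ρ, σ ρ'
  have hβ : ∀ ρ ∈ R, IsOpen (β ρ) := fun ρ hρ => IsOpen.sdiff (hw ρ hρ)
    (isClosed_biUnion_finset fun ρ' hρ' => hS.isClosed _ (hσ ρ' (Finset.mem_of_mem_erase hρ')))
  have hκβ : ∀ ρ ∈ R, κ ρ ⊆ β ρ := by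
    intro ρ hρ s hs
    refine ⟨hκw ρ hρ hs, fun h => ?_⟩
    simp only [mem_iUnion] at h
    obtain ⟨ρ', hρ', hs'⟩ := h
    refine hσκ ρ' (Finset.mem_of_mem_erase hρ') hs' ?_
    simp only [mem_iUnion]
    exact ⟨ρ, Finset.mem_erase.2 ⟨(Finset.ne_of_mem_erase hρ').symm, hρ⟩, hs⟩
  have hβd : ∀ ρ ∈ R, ∀ ρ' ∈ R, ρ ≠ ρ' → ∀ s ∈ β ρ, s ∉ β ρ' := by
    intro ρ hρ ρ' hρ' hne s hs hs'
    refine hs'.2 ?_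
    simp only [mem_iUnion]
    exact ⟨ρ, Finset.mem_erase.2 ⟨hne, hρ⟩, hwσ ρ hρ hs.1⟩
  -- Here β ρ gives disjointness, γ ρ the closeness to ν, and O ρ the prescribed support.
  have hopen : ∀ ρ ∈ R, IsOpen (β ρ ∩ γ ρ ∩ O ρ) := fun ρ hρ =>
    ((hβ ρ hρ).inter (hγ ρ hρ)).inter (hO ρ hρ)
  have hκopen : ∀ ρ ∈ R, κ ρ ⊆ β ρ ∩ γ ρ ∩ O ρ := fun ρ hρ =>
    subset_inter (subset_inter (hκβ ρ hρ) ((hκρ ρ hρ).trans (hργ ρ hρ)))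
      ((hκρ ρ hρ).trans (hRO ρ hρ))
  choose! φ hφ using fun ρ (hρ : ρ ∈ R) =>
    hS.exists_cutoff (κ ρ) (hκ ρ hρ) _ (hopen ρ hρ) (hκopen ρ hρ)
  refine ⟨κ, φ, hκρ, fun ρ hρ => ?_, fun ρ hρ => ?_, fun ρ hρ x hx hxr => ?_,
    fun ρ hρ ρ' hρ' hne s => ?_⟩
  · exact ((hsm ρ hρ).mono (sdiff_subset_sdiff_left (hργ ρ hρ))).mono_le (by linarith)
      (by linarith)
  · obtain ⟨τ, hτ, hτs, h0⟩ := (hφ ρ hρ).supportedBy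
    exact { hφ ρ hρ with supportedBy := ⟨τ, hτ, fun s hs => (hτs hs).2, h0⟩ }
  · have h1 := hS.genNu_sub_genTau_le hℓ hp (hκ ρ hρ) hxr (hγ ρ hρ) (hκρ ρ hρ) (hργ ρ hρ)
      (hsm ρ hρ)
    have h2 := hS.genTau_sub_le hℓ hp (hκ ρ hρ) hxr (hopen ρ hρ) (hκopen ρ hρ)
      ((hsm ρ hρ).mono (sdiff_subset_sdiff_left fun s hs => hs.1.2)) (f := ⟨_, hx⟩)
      (fun s => ((hφ ρ hρ).norm_smul_le s x).trans hxr) ((hφ ρ hρ).eq_one.smul_const x)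
      ((hφ ρ hρ).smul_supportedBy fun _ => x)
    rw [← sub_add_sub_cancel _ (genTau K ℓ (κ ρ) x) _]
    linarith [map_add_le_add p (genNu K ℓ ρ x - genTau K ℓ (κ ρ) x)
      (genTau K ℓ (κ ρ) x - ℓ ⟨_, hx⟩)]
  · have hz : ∀ ρ ∈ R, s ∉ β ρ → φ ρ s = 0 := by
      intro ρ hρ hs
      obtain ⟨τ, hτ, hτs, h0⟩ := (hφ ρ hρ).supportedBy
      exact h0 s fun h => hs (hτs h).1.1
    by_cases h : s ∈ β ρ
    · exact Or.inr (hz ρ' hρ' (hβd ρ hρ ρ' hρ' hne s h))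
    · exact Or.inl (hz ρ hρ h)

theorem map_sum_le_sum (p : AddGroupSeminorm Z) {ι : Type*} (t : Finset ι) (u : ι → Z) :
    p (∑ i ∈ t, u i) ≤ ∑ i ∈ t, p (u i) := by
  classical
  induction t using Finset.induction_on with
  | empty => simp
  | insert i t hi ih =>
    rw [Finset.sum_insert hi, Finset.sum_insert hi]
    exact (map_add_le_add p _ _).trans (by linarith)

/-- The extra 1 keeps each share of the error positive when the family is empty. -/
theorem sum_div_card_add_one_le (hε : 0 < ε) {ι : Type*} (t : Finset ι) :
    ∑ _i ∈ t, ε / (t.card + 1) ≤ ε := by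
  rw [Finset.sum_const, nsmul_eq_mul, mul_div_assoc', div_le_iff₀ (by positivity)]
  nlinarith

theorem map_sum_sub_sum_le {ι : Type*} {t : Finset ι} {u v : ι → Z} (hε : 0 < ε)
    (h : ∀ i ∈ t, p (u i - v i) ≤ ε / (t.card + 1)) : p (∑ i ∈ t, u i - ∑ i ∈ t, v i) ≤ ε := by
  rw [← Finset.sum_sub_distrib]
  exact (map_sum_le_sum p t _).trans ((Finset.sum_le_sum h).trans (sum_div_card_add_one_le hε t))

/-- The sums `∑ ν_ℓ(ρ)(y_ρ)` are approximated by `ℓ (T y)` for a suitable linear `T`. -/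
theorem IsCutoffSystem.exists_sum_approx (hS : IsCutoffSystem K F) (hℓ : IsExhaustive ℓ)
    (hp : Continuous p) (hr : 0 ≤ r) (hε : 0 < ε) (R : Finset (Set S))
    (hR : ∀ ρ ∈ R, IsRegularFor K ℓ ρ) (hd : (R : Set (Set S)).PairwiseDisjoint id)
    {γ : Set S} (hγ : IsOpen γ) (hRγ : ∀ ρ ∈ R, ρ ⊆ γ) :
    ∃ T : (Set S → X) → F, (∀ y z, T (y - z) = T y - T z) ∧
      (∀ y C, 0 ≤ C → (∀ ρ ∈ R, ‖y ρ‖ ≤ C) → ∀ s, ‖(T y : S → X) s‖ ≤ C) ∧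
      (∀ y, SupportedBy K (T y : S → X) γ) ∧
      ∀ y, (∀ ρ ∈ R, ‖y ρ‖ ≤ r) → p (∑ ρ ∈ R, genNu K ℓ ρ (y ρ) - ℓ (T y)) ≤ ε := by
  obtain ⟨κ, φ, -, -, hφ, hpφ, hφd⟩ := hS.exists_disjoint_cutoffs hℓ hp hr
    (by positivity : 0 < ε / (R.card + 1)) R hR hd (O := fun _ => γ) (fun _ _ => hγ) hRγ
  let T : (Set S → X) → F := fun y =>
    ∑ ρ ∈ R.attach, ⟨fun s => φ ρ s • y ρ, (hφ ρ ρ.2).const_mem (y ρ)⟩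
  have hT : ∀ y s, (T y : S → X) s = ∑ ρ ∈ R, φ ρ s • y ρ := by
    intro y s
    simp only [T, Submodule.coe_sum, Finset.sum_apply]
    exact Finset.sum_attach R fun ρ => φ ρ s • y ρ
  refine ⟨T, fun y z => ?_, fun y C hC hy s => ?_, fun y => ?_, fun y hy => ?_⟩
  · ext s
    rw [hT]
    change _ = (T y : S → X) s - (T z : S → X) s
    rw [hT, hT, ← Finset.sum_sub_distrib]
    exact Finset.sum_congr rfl fun ρ _ => smul_sub _ _ _
  · rw [hT]
    exact norm_sum_smul_le_of_disjoint hφd (fun ρ hρ => (hφ ρ hρ).mem_Icc) hC s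
      fun ρ hρ _ => hy ρ hρ
  · have : (T y : S → X) = ∑ ρ ∈ R, fun s => φ ρ s • y ρ := by
      ext s
      rw [hT, Finset.sum_apply]
    rw [this]
    exact hS.supportedBy_sum R fun ρ hρ => (hφ ρ hρ).smul_supportedBy fun _ => y ρ
  · rw [map_sum, ← Finset.sum_attach R]
    refine map_sum_sub_sum_le hε fun ρ _ => ?_
    rw [Finset.card_attach]
    exact hpφ ρ ρ.2 _ _ (hy ρ ρ.2)

/-- Riemann sums of `f` over sufficiently fine finite regular partitions approximate `ℓ f`. -/
theorem IsCutoffSystem.exists_riemann_sum_le (hS : IsCutoffSystem K F) (hℓ : IsExhaustive ℓ)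
    (hp : Continuous p) (hr : 0 ≤ r) (hε : 0 < ε) {f : F} (hf : ∀ s, ‖(f : S → X) s‖ ≤ r) :
    ∃ δ > 0, ∀ R : Finset (Set S), (∀ ρ ∈ R, IsRegularFor K ℓ ρ) →
      (R : Set (Set S)).PairwiseDisjoint id →
      SupportedBy K (f : S → X) (⋃₀ (R : Set (Set S))) → ∀ y : Set S → X, (∀ ρ ∈ R, ‖y ρ‖ ≤ r) →
      (∀ ρ ∈ R, ∀ t ∈ ρ, ‖(f : S → X) t - y ρ‖ < δ) →
      p (ℓ f - ∑ ρ ∈ R, genNu K ℓ ρ (y ρ)) ≤ ε := by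
  have hε3 : 0 < ε / 3 := by positivity
  -- δ comes from uniform continuity alone, hence does not depend on the partition.
  obtain ⟨δ, hδ, hδℓ⟩ := hℓ.exists_le p hp (ε / 3) hε3
  refine ⟨δ, hδ, fun R hR hd hfR y hy hfy => ?_⟩
  obtain ⟨κ, φ, hκρ, hsm, hφ, hpφ, hφd⟩ := hS.exists_disjoint_cutoffs hℓ hp hr
    (by positivity : 0 < ε / 3 / (R.card + 1)) R hR hd
    (O := fun ρ => {t | ‖(f : S → X) t - y ρ‖ < δ})
    (fun ρ _ => isOpen_lt ((hS.continuous f f.2).sub continuous_const).norm continuous_const)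
    hfy
  have hI : ∀ ρ ∈ R, ∀ s, φ ρ s ∈ Icc (0 : ℝ) 1 := fun ρ hρ => (hφ ρ hρ).mem_Icc
  let g : F := ∑ ρ ∈ R.attach, ⟨fun s => φ ρ s • y ρ, (hφ ρ ρ.2).const_mem (y ρ)⟩
  let m : F := ∑ ρ ∈ R.attach, ⟨fun s => φ ρ s • (f : S → X) s, (hφ ρ ρ.2).smul_mem f f.2⟩
  have hg : ∀ s, (g : S → X) s = ∑ ρ ∈ R, φ ρ s • y ρ := by
    intro s
    simp only [g, Submodule.coe_sum, Finset.sum_apply]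
    exact Finset.sum_attach R fun ρ => φ ρ s • y ρ
  have hm : ∀ s, (m : S → X) s = ∑ ρ ∈ R, φ ρ s • (f : S → X) s := by
    intro s
    simp only [m, Submodule.coe_sum, Finset.sum_apply]
    exact Finset.sum_attach R fun ρ => φ ρ s • (f : S → X) s
  have h1 : p (ℓ g - ∑ ρ ∈ R, genNu K ℓ ρ (y ρ)) ≤ ε / 3 := by
    rw [map_sub_rev, map_sum, ← Finset.sum_attach R]
    refine map_sum_sub_sum_le hε3 fun ρ _ => ?_
    rw [Finset.card_attach]
    exact hpφ ρ ρ.2 _ _ (hy ρ ρ.2)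
  -- Where φ ρ is nonzero, f is within δ of y ρ; by disjointness m - g is bounded by δ everywhere.
  have h2 : p (ℓ (m - g)) ≤ ε / 3 := by
    refine hδℓ _ fun s => ?_
    change ‖(m : S → X) s - (g : S → X) s‖ ≤ δ
    rw [hm, hg, ← Finset.sum_sub_distrib]
    simp only [← smul_sub]
    refine norm_sum_smul_le_of_disjoint hφd hI hδ.le s fun ρ hρ h0 => ?_
    obtain ⟨σ, hσ, hσO, hσ0⟩ := (hφ ρ hρ).supportedBy
    have : s ∈ σ := by
      by_contra h
      exact h0 (hσ0 s h)
    exact (hσO this).le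
  -- Near κ ρ the function m equals f, so f - m is supported by the union of the small sets ρ \ κ ρ.
  have h3 : p (ℓ (f - m)) ≤ ε / 3 := by
    choose! w hw hκw hw1 using fun ρ (hρ : ρ ∈ R) => (hφ ρ hρ).eq_one
    have hsm' := (hS.smallOn_biUnion R hsm).mono_le le_rfl (sum_div_card_add_one_le hε3 R)
    refine hsm'.le _ (fun s => ?_) (hS.supportedBy_of_eq_zero (α := ⋃₀ (R : Set (Set S)))
      (w := ⋃ ρ ∈ R, w ρ) ?_ (isOpen_biUnion hw) ?_ ?_)
    · change ‖(f : S → X) s - (m : S → X) s‖ ≤ r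
      rw [hm]
      rcases forall_eq_zero_or_exists_of_disjoint hφd s with h | ⟨ρ, hρ, -, h⟩
      · rw [Finset.sum_eq_zero fun ρ hρ => by rw [h ρ hρ, zero_smul], sub_zero]
        exact hf s
      · rw [Finset.sum_eq_single ρ (fun ρ' hρ' hne => by rw [h ρ' hρ' hne, zero_smul])
          (fun h => absurd hρ h)]
        have : (f : S → X) s - φ ρ s • (f : S → X) s = (1 - φ ρ s) • (f : S → X) s := by
          rw [sub_smul, one_smul]
        rw [this, norm_smul, Real.norm_of_nonneg (by linarith [(hI ρ hρ s).2])]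
        exact (mul_le_of_le_one_left (norm_nonneg _) (by linarith [(hI ρ hρ s).1])).trans (hf s)
    · obtain ⟨σ, hσ, hσR, h0⟩ := hfR
      refine ⟨σ, hσ, hσR, fun s hs => ?_⟩
      change (f : S → X) s - (m : S → X) s = 0
      rw [hm, h0 s hs]
      simp
    · intro s hs
      simp only [mem_iUnion] at hs
      obtain ⟨ρ, hρ, hs⟩ := hs
      change (f : S → X) s - (m : S → X) s = 0
      have h1 := hw1 ρ hρ s hs
      rw [hm, Finset.sum_eq_single ρ (fun ρ' hρ' hne => ?_) (fun h => absurd hρ h), h1, one_smul,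
        sub_self]
      rw [(hφd ρ' hρ' ρ hρ hne s).resolve_right (by rw [h1]; exact one_ne_zero), zero_smul]
    · rintro s ⟨⟨ρ, hρ, hs⟩, hsw⟩
      simp only [mem_iUnion] at hsw ⊢
      exact ⟨ρ, hρ, hs, fun h => hsw ⟨ρ, hρ, hκw ρ hρ h⟩⟩
  have h4 : ℓ f - ∑ ρ ∈ R, genNu K ℓ ρ (y ρ) =
      ℓ (f - m) + ℓ (m - g) + (ℓ g - ∑ ρ ∈ R, genNu K ℓ ρ (y ρ)) := by
    rw [map_sub, map_sub]
    abel
  rw [h4]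
  linarith [map_add_le_add p (ℓ (f - m) + ℓ (m - g)) (ℓ g - ∑ ρ ∈ R, genNu K ℓ ρ (y ρ)),
    map_add_le_add p (ℓ (f - m)) (ℓ (m - g))]

/-- Open sets have finite regular partitions on whose members `f` oscillates little. -/
theorem IsCutoffSystem.exists_fine_partition (hS : IsCutoffSystem K F) (hℓ : IsExhaustive ℓ)
    (f : F) {δ : ℝ} (hδ : 0 < δ) {γ : Set S} (hγ : IsOpen γ) :
    ∃ Q : Finset (Set S), (∀ q ∈ Q, IsRegularFor K ℓ q) ∧
      (Q : Set (Set S)).PairwiseDisjoint id ∧ ⋃₀ (Q : Set (Set S)) = γ ∧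
      ∀ q ∈ Q, ∀ s ∈ q, ∀ t ∈ q, ‖(f : S → X) s - (f : S → X) t‖ < δ := by
  classical
  obtain ⟨C, hC⟩ := hS.bounded f f.2
  obtain ⟨T, hT, hcov⟩ := Metric.totallyBounded_iff.1
    (isCompact_closedBall (0 : X) C).totallyBounded (δ / 2) (half_pos hδ)
  have hopen : ∀ x, IsOpen ((f : S → X) ⁻¹' Metric.ball x (δ / 2) ∩ γ) := fun x =>
    (Metric.isOpen_ball.preimage (hS.continuous f f.2)).inter hγ
  obtain ⟨Q, hQ, hd, hU, hsub⟩ := (hS.isSetAlgebra hℓ).exists_disjoint_refinement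
    (hT.toFinset.image fun x => (f : S → X) ⁻¹' Metric.ball x (δ / 2) ∩ γ) (by
      intro c hc
      obtain ⟨x, -, rfl⟩ := Finset.mem_image.1 hc
      exact hS.isRegularFor_of_isOpen hℓ (hopen x))
  refine ⟨Q, hQ, hd, hU.trans (Subset.antisymm ?_ ?_), fun q hq s hs t ht => ?_⟩
  · refine sUnion_subset fun c hc => ?_
    obtain ⟨x, -, rfl⟩ := Finset.mem_image.1 hc
    exact inter_subset_right
  · intro s hs
    have h1 := hcov (mem_closedBall_zero_iff.2 (hC s))
    simp only [mem_iUnion] at h1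
    obtain ⟨x, hx, hsx⟩ := h1
    exact ⟨_, Finset.mem_coe.2 (Finset.mem_image_of_mem _ (hT.mem_toFinset.2 hx)), hsx, hs⟩
  · obtain ⟨c, hc, hqc⟩ := hsub q hq
    obtain ⟨x, -, rfl⟩ := Finset.mem_image.1 hc
    have h1 := (hqc hs).1
    have h2 := (hqc ht).1
    rw [mem_preimage, Metric.mem_ball] at h1 h2
    rw [← dist_eq_norm]
    linarith [dist_triangle_right ((f : S → X) s) ((f : S → X) t) x]

end RiemannSums

/-! ### The representation theorem for cutoff systems -/

section Representation

set_option linter.unusedSectionVars false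

variable {S X Z : Type*} [TopologicalSpace S] [NormedAddCommGroup X] [NormedSpace ℝ X]
  [ProperSpace X] [AddCommGroup Z] [Module ℝ Z] [UniformSpace Z] [IsUniformAddGroup Z] [T2Space Z]
  {K : Set (Set S)} {F : Submodule ℝ (S → X)} {ℓ : F →ₗ[ℝ] Z}
  {p : AddGroupSeminorm Z} {r ε : ℝ}

/-- Up to approximation errors, the increment of the sum from x to x + y is ℓ(T(x + y)) - ℓ(T x) =
ℓ(T y), and T y is bounded by r and supported by γ. -/
theorem IsCutoffSystem.isSmall_of_smallOn (hS : IsCutoffSystem K F) (hℓ : IsExhaustive ℓ)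
    (hp : Continuous p) (hr : 0 ≤ r) {B : Set X} (hB : ∀ x ∈ B, ‖x‖ ≤ r) {V : Set (Z × Z)}
    (hV : ∀ a b, p (b - a) < 1 → (a, b) ∈ V) {α : Set S} (h : SmallOn K ℓ p r (1 / 2) α) :
    IsSmall K {γ : Set S | IsOpen γ} (genNu K ℓ) B V α := by
  obtain ⟨γ, hγ, hαγ, H⟩ := h
  refine ⟨γ, hγ, hαγ, fun L hL hd hLγ x y hx hy => hV _ _ ?_⟩
  -- The radius 2r accommodates x + y; the total error is 1/8 + 1/8 + 1/2 < 1.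
  obtain ⟨T, hTsub, hTn, hTs, hT⟩ := hS.exists_sum_approx hℓ hp (r := 2 * r) (by linarith)
    (by norm_num : (0 : ℝ) < 1 / 8) L (fun κ hκ => hS.isRegularFor_of_mem hℓ (hL hκ)) hd hγ hLγ
  have h1 := hT x fun κ hκ => (hB _ (hx κ hκ)).trans (by linarith)
  have h2 := hT (x + y) fun κ hκ => (norm_add_le _ _).trans
    (by linarith [hB _ (hx κ hκ), hB _ (hy κ hκ)])
  have h3 := H (T y) (hTn y r hr fun κ hκ => hB _ (hy κ hκ)) (hTs y)
  have h4 : ℓ (T y) = ℓ (T (x + y)) - ℓ (T x) := by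
    rw [← map_sub, ← hTsub, add_sub_cancel_left]
  have h5 : ∑ κ ∈ L, genNu K ℓ κ (x κ + y κ) - ∑ κ ∈ L, genNu K ℓ κ (x κ) =
      (∑ κ ∈ L, genNu K ℓ κ ((x + y) κ) - ℓ (T (x + y))) -
        (∑ κ ∈ L, genNu K ℓ κ (x κ) - ℓ (T x)) + ℓ (T y) := by
    rw [h4]
    simp only [Pi.add_apply]
    abel
  rw [h5]
  linarith [map_add_le_add p ((∑ κ ∈ L, genNu K ℓ κ ((x + y) κ) - ℓ (T (x + y))) -
        (∑ κ ∈ L, genNu K ℓ κ (x κ) - ℓ (T x))) (ℓ (T y)),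
    map_sub_le_add p (∑ κ ∈ L, genNu K ℓ κ ((x + y) κ) - ℓ (T (x + y)))
        (∑ κ ∈ L, genNu K ℓ κ (x κ) - ℓ (T x))]

theorem IsCutoffSystem.genNu_empty (hS : IsCutoffSystem K F) (hℓ : IsExhaustive ℓ) (x : X) :
    genNu K ℓ ∅ x = 0 := by
  have h := hS.isRegularFor_of_isOpen hℓ isOpen_empty
  have := hS.genNu_union hℓ h h (disjoint_empty ∅) x
  rw [union_empty] at this
  simpa using this

/-- A Riemann sum over a fine partition of γ approximates ℓ f. Shrinking its members to sets in K
changes it little, and the hypothesis bounds the resulting sum. -/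
theorem IsCutoffSystem.smallOn_of_isSmall (hS : IsCutoffSystem K F) (hℓ : IsExhaustive ℓ)
    (hp : Continuous p) (hr : 0 ≤ r) (hε : 0 < ε) {α : Set S}
    (h : IsSmall K {γ : Set S | IsOpen γ} (genNu K ℓ) (Metric.closedBall 0 r)
      {q | p (q.2 - q.1) < ε / 3} α) : SmallOn K ℓ p r ε α := by
  classical
  obtain ⟨γ, hγ, hαγ, H⟩ := h
  refine ⟨γ, hγ, hαγ, fun f hf hfγ => ?_⟩
  have hε3 : 0 < ε / 3 := by positivity
  obtain ⟨δ, hδ, hR⟩ := hS.exists_riemann_sum_le hℓ hp hr hε3 hf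
  obtain ⟨Q, hQ, hd, hU, hosc⟩ := hS.exists_fine_partition hℓ f hδ hγ
  -- The value 0 on the empty set is arbitrary; it only has to respect the bound r.
  let y : Set S → X := fun q => if h : q.Nonempty then (f : S → X) h.some else 0
  have hy : ∀ q, ‖y q‖ ≤ r := by
    intro q
    simp only [y]
    split_ifs
    · exact hf _
    · simpa using hr
  have h1 := hR Q hQ hd (by rwa [hU]) y (fun q _ => hy q) (by
    intro q hq t ht
    have hne : q.Nonempty := ⟨t, ht⟩
    simp only [y, dif_pos hne]
    exact hosc q hq t ht _ hne.some_mem)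
  choose! κ hκ γ' hγ' hκq hqγ' hsm using fun q (hq : q ∈ Q) =>
    hQ q hq p hp (2 * r) (ε / 3 / (Q.card + 1)) (by positivity)
  have h2 : p (∑ q ∈ Q, genNu K ℓ q (y q) - ∑ q ∈ Q, genNu K ℓ (κ q) (y q)) ≤ ε / 3 := by
    refine map_sum_sub_sum_le hε3 fun q hq => ?_
    rw [hS.genNu_eq_genTau hℓ (hκ q hq)]
    exact hS.genNu_sub_genTau_le hℓ hp (hκ q hq) (hy q) (hγ' q hq) (hκq q hq) (hqγ' q hq)
      (hsm q hq)
  -- Several q could have empty κ q. Dropping these makes κ injective, so the sum can be indexed by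
  -- a finite set of members of K, and loses nothing because ν(∅) = 0.
  let Q' := Q.filter fun q => (κ q).Nonempty
  have hQ' : ∀ q ∈ Q', q ∈ Q := fun q hq => (Finset.mem_filter.1 hq).1
  have hinj : InjOn κ (Q' : Set (Set S)) := by
    intro q hq q' hq' heq
    by_contra hne
    obtain ⟨s, hs⟩ := (Finset.mem_filter.1 hq).2
    have hs' : s ∈ κ q' := heq ▸ hs
    exact (hd (hQ' q hq) (hQ' q' hq') hne).le_bot ⟨hκq _ (hQ' q hq) hs, hκq _ (hQ' q' hq') hs'⟩
  let z : Set S → X := fun c => y (Function.invFunOn κ (Q' : Set (Set S)) c)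
  have h3 : ∑ q ∈ Q, genNu K ℓ (κ q) (y q) = ∑ c ∈ Q'.image κ, genNu K ℓ c (z c) := by
    rw [Finset.sum_image hinj]
    have hz : ∀ q ∈ Q', genNu K ℓ (κ q) (z (κ q)) = genNu K ℓ (κ q) (y q) := fun q hq => by
      simp only [z]
      rw [hinj.leftInvOn_invFunOn hq]
    rw [Finset.sum_congr rfl hz]
    refine (Finset.sum_filter_of_ne fun q _ hne => ?_).symm
    by_contra hem
    rw [not_nonempty_iff_eq_empty] at hem
    rw [hem, hS.genNu_empty hℓ] at hne
    exact hne rfl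
  have hmem : ∀ c ∈ Q'.image κ, ∃ q ∈ Q', κ q = c := fun c hc => Finset.mem_image.1 hc
  have h4 := H (Q'.image κ)
    (by
      intro c hc
      obtain ⟨q, hq, rfl⟩ := hmem c hc
      exact hκ q (hQ' q hq))
    (by
      intro c hc c' hc' hne
      obtain ⟨q, hq, rfl⟩ := hmem c hc
      obtain ⟨q', hq', rfl⟩ := hmem c' hc'
      exact (hd (hQ' q hq) (hQ' q' hq') fun h => hne (by rw [h])).mono (hκq q (hQ' q hq))
        (hκq q' (hQ' q' hq')))
    (by
      intro c hc
      obtain ⟨q, hq, rfl⟩ := hmem c hc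
      refine (hκq q (hQ' q hq)).trans ?_
      rw [← hU]
      exact subset_sUnion_of_mem (Finset.mem_coe.2 (hQ' q hq)))
    0 z (fun c _ => Metric.mem_closedBall_self hr) (fun c _ => mem_closedBall_zero_iff.2 (hy _))
  -- With x = 0 the first entry of the pair vanishes, so the entourage condition bounds the sum
  -- itself.
  have h5 : ∑ c ∈ Q'.image κ, genNu K ℓ c ((0 : Set S → X) c) = 0 := by
    refine Finset.sum_eq_zero fun c hc => ?_
    obtain ⟨q, hq, rfl⟩ := hmem c hc
    rw [hS.genNu_eq_genTau hℓ (hκ q (hQ' q hq))]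
    exact hS.genTau_zero hℓ (hκ q (hQ' q hq))
  simp only [Pi.zero_apply] at h5
  simp only [mem_ofPred_eq, Pi.zero_apply, zero_add, h5, sub_zero] at h4
  rw [h3] at h2
  have h6 : ℓ f = (ℓ f - ∑ q ∈ Q, genNu K ℓ q (y q)) +
      (∑ q ∈ Q, genNu K ℓ q (y q) - ∑ c ∈ Q'.image κ, genNu K ℓ c (z c)) +
      ∑ c ∈ Q'.image κ, genNu K ℓ c (z c) := by abel
  rw [h6]
  have h7 := map_add_le_add p (ℓ f - ∑ q ∈ Q, genNu K ℓ q (y q))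
    (∑ q ∈ Q, genNu K ℓ q (y q) - ∑ c ∈ Q'.image κ, genNu K ℓ c (z c))
  have h8 := map_add_le_add p ((ℓ f - ∑ q ∈ Q, genNu K ℓ q (y q)) +
    (∑ q ∈ Q, genNu K ℓ q (y q) - ∑ c ∈ Q'.image κ, genNu K ℓ c (z c)))
    (∑ c ∈ Q'.image κ, genNu K ℓ c (z c))
  linarith

/-- The regular sets of `ν_ℓ` are the regular sets of `ℓ`. -/
theorem IsCutoffSystem.regularSets_genNu (hS : IsCutoffSystem K F) (hℓ : IsExhaustive ℓ) :
    regularSets K {γ : Set S | IsOpen γ} (closedBalancedTotallyBounded X) (genNu K ℓ) =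
      {α | IsRegularFor K ℓ α} := by
  ext α
  constructor
  · intro h p hp r ε hε
    -- r may be negative, whereas the test set must be a nonempty ball.
    have hr : 0 ≤ max r 0 := le_max_right _ _
    obtain ⟨κ, hκ, γ, hγ, hκα, hαγ, hsm⟩ := h _
      (closedBall_mem_closedBalancedTotallyBounded hr) _
      (addGroupSeminorm_mem_uniformity hp (by positivity : 0 < ε / 3))
    exact ⟨κ, hκ, γ, hγ, hκα, hαγ, (hS.smallOn_of_isSmall hℓ hp hr hε hsm).mono_le
      (le_max_left _ _) le_rfl⟩
  · intro h B hB V hV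
    obtain ⟨r, hr, hBr⟩ := exists_norm_le_of_mem_closedBalancedTotallyBounded hB
    obtain ⟨p, hp, hpV⟩ := exists_addGroupSeminorm_of_mem_uniformity hV
    obtain ⟨κ, hκ, γ, hγ, hκα, hαγ, hsm⟩ := h p hp r (1 / 2) (by norm_num)
    exact ⟨κ, hκ, γ, hγ, hκα, hαγ, hS.isSmall_of_smallOn hℓ hp hr hBr hpV hsm⟩

/-- Infinitely many exceptions would form a disjoint sequence without small members. -/
theorem IsCutoffSystem.eventually_smallOn (hS : IsCutoffSystem K F) (hℓ : IsExhaustive ℓ)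
    (hp : Continuous p) (r : ℝ) (hε : 0 < ε) {α : ℕ → Set S}
    (hα : ∀ k, IsRegularFor K ℓ (α k)) (hd : Pairwise fun i j => Disjoint (α i) (α j)) :
    ∃ m, ∀ n > m, SmallOn K ℓ p r ε (α n) := by
  by_contra! H
  have hfreq : ∃ᶠ n in atTop, ¬ SmallOn K ℓ p r ε (α n) := by
    rw [frequently_atTop]
    intro m
    obtain ⟨n, hn, h⟩ := H m
    exact ⟨n, hn.le, h⟩
  obtain ⟨φ, hφ, h⟩ := extraction_of_frequently_atTop hfreq
  obtain ⟨k, hk⟩ := hS.exists_smallOn hℓ hp r hε (fun k => hα (φ k))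
    fun i j hij => hd (hφ hij).ne
  exact h k hk

/-- All partition sums with values in a ball lie in one complete set, whatever the number of pieces;
this gives the relative completeness required of a Riesz measure. -/
theorem IsCutoffSystem.sum_genNu_mem_closure (hS : IsCutoffSystem K F) (hℓ : IsExhaustive ℓ)
    (hr : 0 ≤ r) {R : Finset (Set S)} (hR : ∀ ρ ∈ R, IsRegularFor K ℓ ρ)
    (hd : (R : Set (Set S)).PairwiseDisjoint id) {x : Set S → X} (hx : ∀ ρ ∈ R, ‖x ρ‖ ≤ r) :
    ∑ ρ ∈ R, genNu K ℓ ρ (x ρ) ∈ closure (ℓ '' {f : F | ∀ s, ‖(f : S → X) s‖ ≤ r}) := by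
  refine mem_closure_of_addGroupSeminorm fun p hp ε hε => ?_
  obtain ⟨T, -, hTn, -, hT⟩ := hS.exists_sum_approx hℓ hp hr hε R hR hd isOpen_univ
    fun _ _ => subset_univ _
  exact ⟨ℓ (T x), ⟨T x, hTn x r hr hx, rfl⟩, hT x hx⟩

theorem IsComplete.closure_of_subset {E C : Set Z} (hC : IsComplete C) (hCc : IsClosed C)
    (h : E ⊆ C) : IsComplete (closure E) := by
  intro l hl hlE
  have hsub : closure E ⊆ C := closure_minimal h hCc
  obtain ⟨z, -, hz⟩ := hC l hl (hlE.trans (principal_mono.2 hsub))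
  have := hl.1
  exact ⟨z, isClosed_closure.mem_of_tendsto hz (le_principal_iff.1 hlE), hz⟩

theorem IsCutoffSystem.isRieszMeasure_genNu (hS : IsCutoffSystem K F) (hℓ : IsExhaustive ℓ) :
    IsRieszMeasure K {γ : Set S | IsOpen γ} (closedBalancedTotallyBounded X) (genNu K ℓ) where
  subset_regularSets := by
    rw [hS.regularSets_genNu hℓ]
    exact fun γ hγ => hS.isRegularFor_of_isOpen hℓ hγ
  isSetAlgebra := by
    rw [hS.regularSets_genNu hℓ]
    exact hS.isSetAlgebra hℓ
  map_empty := funext fun x => hS.genNu_empty hℓ x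
  additive := by
    rw [hS.regularSets_genNu hℓ]
    intro α hα β hβ
    have h𝒜 := hS.isSetAlgebra hℓ
    funext x
    -- Disjoint additivity is applied to α ∪ β = α ⊔ (β \ α) and β = (β \ α) ⊔ (α ∩ β).
    have h1 := hS.genNu_union hℓ hα (h𝒜.sdiff_mem hβ hα) disjoint_sdiff_right x
    have h2 := hS.genNu_union hℓ (h𝒜.sdiff_mem hβ hα) (h𝒜.inter_mem hα hβ)
      (disjoint_left.2 fun s hs hs' => hs.2 hs'.1) x
    rw [union_sdiff_self] at h1
    rw [inter_comm, sdiff_union_inter, inter_comm] at h2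
    change genNu K ℓ (α ∪ β) x + genNu K ℓ (α ∩ β) x = genNu K ℓ α x + genNu K ℓ β x
    rw [h1, h2]
    abel
  inner_limit := by
    intro γ hγ x
    rw [hS.genNu_eq_genXi hℓ hγ]
    refine (hS.tendsto_genXi hℓ hγ x).congr fun κ => ?_
    exact (hS.genNu_eq_genTau hℓ κ.2.1 x).symm
  outer_limit := by
    intro α x
    refine (hS.tendsto_genNu hℓ α x).congr fun γ => ?_
    exact (hS.genNu_eq_genXi hℓ γ.2.1 x).symm
  partition_continuous := by
    rw [hS.regularSets_genNu hℓ]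
    intro W hW B hB
    obtain ⟨r, hr, hBr⟩ := exists_norm_le_of_mem_closedBalancedTotallyBounded hB
    obtain ⟨p, hp, hpW⟩ := exists_addGroupSeminorm_of_mem_uniformity hW
    obtain ⟨δ, hδ, hδℓ⟩ := hℓ.exists_le p hp (1 / 4) (by norm_num)
    refine ⟨{q | dist q.1 q.2 < δ}, Metric.dist_mem_uniformity hδ, ?_⟩
    intro R hR hd x y hx hy hxy
    obtain ⟨T, hTsub, hTn, -, hT⟩ := hS.exists_sum_approx hℓ hp hr
      (by norm_num : (0 : ℝ) < 1 / 8) R hR hd isOpen_univ fun _ _ => subset_univ _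
    have h1 := hT x fun ρ hρ => hBr _ (hx ρ hρ)
    have h2 := hT y fun ρ hρ => hBr _ (hy ρ hρ)
    have h3 := hδℓ (T (y - x)) (hTn _ δ hδ.le fun ρ hρ => by
      have := hxy ρ hρ
      rw [mem_ofPred_eq, dist_comm, dist_eq_norm] at this
      exact this.le)
    refine hpW _ _ ?_
    have h4 : ∑ ρ ∈ R, genNu K ℓ ρ (y ρ) - ∑ ρ ∈ R, genNu K ℓ ρ (x ρ) =
        (∑ ρ ∈ R, genNu K ℓ ρ (y ρ) - ℓ (T y)) - (∑ ρ ∈ R, genNu K ℓ ρ (x ρ) - ℓ (T x)) +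
          ℓ (T (y - x)) := by
      rw [hTsub, map_sub]
      abel
    rw [h4]
    linarith [map_add_le_add p ((∑ ρ ∈ R, genNu K ℓ ρ (y ρ) - ℓ (T y)) -
        (∑ ρ ∈ R, genNu K ℓ ρ (x ρ) - ℓ (T x))) (ℓ (T (y - x))),
      map_sub_le_add p (∑ ρ ∈ R, genNu K ℓ ρ (y ρ) - ℓ (T y))
        (∑ ρ ∈ R, genNu K ℓ ρ (x ρ) - ℓ (T x))]
  s_bounded := by
    rw [hS.regularSets_genNu hℓ]
    intro B hB α hα hd V hV
    obtain ⟨r, hr, hBr⟩ := exists_norm_le_of_mem_closedBalancedTotallyBounded hB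
    obtain ⟨p, hp, hpV⟩ := exists_addGroupSeminorm_of_mem_uniformity hV
    obtain ⟨m, hm⟩ := hS.eventually_smallOn hℓ hp r (by norm_num : (0 : ℝ) < 1 / 2) hα hd
    exact ⟨m, fun n hn => hS.isSmall_of_smallOn hℓ hp hr hBr hpV (hm n hn)⟩
  relativelyComplete_sums := by
    rw [hS.regularSets_genNu hℓ]
    intro B hB
    obtain ⟨r, hr, hBr⟩ := exists_norm_le_of_mem_closedBalancedTotallyBounded hB
    refine (hℓ.isComplete r).closure_of_subset isClosed_closure ?_
    rintro z ⟨R, x, hR, hd, hx, rfl⟩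
    exact hS.sum_genNu_mem_closure hℓ hr hR hd fun ρ hρ => hBr _ (hx ρ hρ)

theorem IsCutoffSystem.hasRieszIntegral (hS : IsCutoffSystem K F) (hℓ : IsExhaustive ℓ) (f : F) :
    HasRieszIntegral K {γ : Set S | IsOpen γ} (closedBalancedTotallyBounded X) (genNu K ℓ) univ
      (f : S → X) (ℓ f) := by
  classical
  intro V hV
  have hV' : (fun w => ℓ f - w) ⁻¹' V ∈ 𝓝 (0 : Z) := by
    apply (continuous_const.sub continuous_id).continuousAt
    simpa using hV
  obtain ⟨p, hp, hpV⟩ := exists_continuous_addGroupSeminorm hV'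
  obtain ⟨C, hC⟩ := hS.bounded f f.2
  have hCr : ∀ s, ‖(f : S → X) s‖ ≤ max C 0 := fun s => (hC s).trans (le_max_left _ _)
  obtain ⟨δ, hδ, hR⟩ := hS.exists_riemann_sum_le hℓ hp (le_max_right _ _)
    (by norm_num : (0 : ℝ) < 1 / 2) hCr
  -- The oscillation bound on members of Q passes to every refinement and every choice of points.
  obtain ⟨Q, hQ, hd, hU, hosc⟩ := hS.exists_fine_partition hℓ f hδ isOpen_univ
  refine ⟨Q, ⟨?_, hd, hU⟩, ?_⟩
  · rw [hS.regularSets_genNu hℓ]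
    exact hQ
  · rintro R ⟨hRr, hRd, hRU⟩ hRQ s hs
    rw [hS.regularSets_genNu hℓ] at hRr
    let y : Set S → X := fun ρ => if h : ρ ∈ R then (f : S → X) (s ⟨ρ, h⟩) else 0
    have hy : ∀ ρ (h : ρ ∈ R), y ρ = (f : S → X) (s ⟨ρ, h⟩) := fun ρ h => dif_pos h
    have h1 := hR R hRr hRd (by rw [hRU]; exact hS.supported f f.2) y
      (fun ρ hρ => by rw [hy ρ hρ]; exact hCr _)
      (fun ρ hρ t ht => by
        obtain ⟨q, hq, hρq⟩ := hRQ ρ hρ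
        rw [hy ρ hρ]
        exact hosc q hq t (hρq ht) _ (hρq (hs ⟨ρ, hρ⟩)))
    have h2 : ∑ ρ : R, genNu K ℓ ρ ((f : S → X) (s ρ)) = ∑ ρ ∈ R, genNu K ℓ ρ (y ρ) := by
      rw [← Finset.sum_coe_sort R]
      exact Finset.sum_congr rfl fun ρ _ => by rw [hy ρ.1 ρ.2]
    have h3 := hpV _ (h1.trans_lt (by norm_num))
    rw [mem_preimage, sub_sub_cancel, ← h2] at h3
    exact h3

theorem IsCutoffSystem.representedByRieszMeasure (hS : IsCutoffSystem K F)
    (hℓ : IsExhaustive ℓ) : RepresentedByRieszMeasure K {γ : Set S | IsOpen γ}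
      (closedBalancedTotallyBounded X) F ℓ where
  approxFilter_neBot := fun _ hκ _ _ hB hx => hS.approxFilter_neBot hκ fun t ht =>
    hB.2.2.1 t (by rw [Real.norm_of_nonneg ht.1]; exact ht.2) (smul_mem_smul_set hx)
  tendsto_tau := fun _ hκ _ _ hB hx => hS.tendsto_genTau hℓ hκ hB hx
  tendsto_xi := fun _ hγ x => hS.tendsto_genXi hℓ hγ x
  tendsto_nu := fun α x => hS.tendsto_genNu hℓ α x
  isRieszMeasure := hS.isRieszMeasure_genNu hℓ
  hasIntegral := hS.hasRieszIntegral hℓ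

/-- Continuity for uniform convergence yields exhaustivity if the bounded subsets of the range
are relatively complete and perfect. -/
theorem IsExhaustive.of_continuous [ContinuousSMul ℝ Z]
    (hZ : ∀ E : Set Z, Bornology.IsVonNBounded ℝ E → RelativelyComplete E ∧ PerfectForSums E)
    (hℓ : ContinuousForUniformConvergence F ℓ) : IsExhaustive ℓ := by
  have hnhds : ∀ V ∈ 𝓝 (0 : Z), ∃ δ > 0, ∀ f : F, (∀ s, ‖(f : S → X) s‖ ≤ δ) → ℓ f ∈ V := by
    intro V hV
    let _ : TopologicalSpace F :=
      TopologicalSpace.induced (fun f : F => UniformFun.ofFun (f : S → X)) inferInstance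
    have hc : Continuous ℓ := hℓ
    have h1 : ℓ ⁻¹' V ∈ 𝓝 (0 : F) := hc.continuousAt.preimage_mem_nhds (by rwa [map_zero])
    rw [nhds_induced] at h1
    obtain ⟨U, hU, hUV⟩ := h1
    obtain ⟨δ, hδ, hδU⟩ := (UniformFun.hasBasis_nhds_of_basis S X _
      Metric.uniformity_basis_dist_le).mem_iff.1 hU
    refine ⟨δ, hδ, fun f hf => hUV (hδU fun s => ?_)⟩
    change dist (0 : X) ((f : S → X) s) ≤ δ
    rw [dist_comm, dist_zero_right]
    exact hf s
  -- Scaling the ball of radius r into that of radius δ shows that V absorbs its image.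
  have hbdd : ∀ r : ℝ, Bornology.IsVonNBounded ℝ (ℓ '' {f : F | ∀ s, ‖(f : S → X) s‖ ≤ r}) := by
    intro r V hV
    obtain ⟨δ, hδ, h⟩ := hnhds V hV
    refine Absorbs.of_norm ⟨max 1 (r / δ), fun c hc => ?_⟩
    rintro _ ⟨f, hf, rfl⟩
    have hc0 : 0 < ‖c‖ := lt_of_lt_of_le one_pos ((le_max_left _ _).trans hc)
    refine ⟨ℓ (c⁻¹ • f), h _ fun s => ?_, ?_⟩
    · change ‖c⁻¹ • (f : S → X) s‖ ≤ δ
      rw [norm_smul, norm_inv, inv_mul_le_iff₀ hc0]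
      have h1 : r / δ ≤ ‖c‖ := (le_max_right _ _).trans hc
      rw [div_le_iff₀ hδ] at h1
      exact (hf s).trans h1
    · change c • ℓ (c⁻¹ • f) = ℓ f
      rw [map_smul, smul_inv_smul₀ (norm_pos_iff.1 hc0)]
  refine ⟨fun p hp ε hε => ?_, fun p hp r ε hε f hf hd => ?_, fun r => (hZ _ (hbdd r)).1⟩
  · refine hnhds {z | p z ≤ ε} ?_
    filter_upwards [hp.continuousAt.preimage_mem_nhds (Iio_mem_nhds (by rwa [map_zero]))]
      with z hz using le_of_lt hz
  -- By disjointness every finite sum of the f k is bounded by `max r 0`, where 0 covers the points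
  -- at which all terms vanish. The partial sums of the images thus lie in one bounded set, which is
  -- perfect.
  · have hsum : Summable fun k => ℓ (f k) := by
      refine (hZ _ (hbdd (max r 0))).2 ℕ _ fun J => ⟨∑ j ∈ J, f j, fun s => ?_, map_sum _ _ _⟩
      rw [Submodule.coe_sum, Finset.sum_apply]
      by_cases h : ∀ j ∈ J, (f j : S → X) s = 0
      · rw [Finset.sum_eq_zero h, norm_zero]
        exact le_max_right _ _
      · push Not at h
        obtain ⟨i, hi, h0⟩ := h
        rw [Finset.sum_eq_single i (fun j _ hne => ?_) (fun h => absurd hi h)]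
        · exact (hf i s).trans (le_max_left _ _)
        · rcases lt_or_gt_of_ne hne with hlt | hlt
          · exact (hd j i hlt s).resolve_right h0
          · exact (hd i j hlt s).resolve_left h0
    have h1 := hp.continuousAt.preimage_mem_nhds (x := (0 : Z)) (t := Iio ε)
      (Iio_mem_nhds (by rwa [map_zero]))
    obtain ⟨k, hk⟩ := (hsum.tendsto_atTop_zero.eventually h1).exists
    exact ⟨k, le_of_lt hk⟩

end Representation

/-! ### Continuous functions and smooth functions with compact support -/

section ConcreteSystems

open scoped Manifold ContDiff

theorem isCutoffSystem_Cp {S X : Type*} [TopologicalSpace S] [NormalSpace S]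
    [NormedAddCommGroup X] [NormedSpace ℝ X] [ProperSpace X] :
    IsCutoffSystem {κ : Set S | IsClosed κ} (Cp S X) where
  isClosed := fun _ h => h
  empty_mem := isClosed_empty
  union_mem := fun _ h _ h' => IsClosed.union h h'
  inter_mem := fun _ h _ h' => IsClosed.inter h h'
  continuous := fun _ hf => hf.1
  bounded := fun f hf => by
    obtain ⟨C, hC⟩ := hf.2.isBounded.exists_norm_le
    exact ⟨C, fun s => hC _ ⟨s, rfl⟩⟩
  supported := fun _ _ => ⟨univ, isClosed_univ, Subset.rfl, fun s hs => absurd trivial hs⟩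
  exists_cutoff := by
    intro κ hκ β hβ hκβ
    -- Two interpolated open sets are needed: Urysohn's function is 1 on the open set u, not merely
    -- on κ, and vanishes off the closed set `closure v` inside β.
    obtain ⟨u, hu, hκu, huβ⟩ := normal_exists_closure_subset hκ hβ hκβ
    obtain ⟨v, hv, huv, hvβ⟩ := normal_exists_closure_subset isClosed_closure hβ huβ
    obtain ⟨φ, hφ0, hφ1, hφ⟩ := exists_continuous_zero_one_of_isClosed hv.isClosed_compl
      (isClosed_closure (s := u)) (disjoint_left.2 fun s hs hs' => hs (huv hs'))
    have hmul : ∀ f : S → X, Continuous f → ∀ C : ℝ, (∀ s, ‖f s‖ ≤ C) →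
        (fun s => φ s • f s) ∈ Cp S X := by
      intro f hf C hC
      refine ⟨φ.continuous.smul hf, (isCompact_closedBall (0 : X) C).totallyBounded.subset ?_⟩
      rintro _ ⟨s, rfl⟩
      rw [mem_closedBall_zero_iff, norm_smul, Real.norm_of_nonneg (hφ s).1]
      exact (mul_le_of_le_one_left (norm_nonneg _) (hφ s).2).trans (hC s)
    refine ⟨φ, hφ, ⟨u, hu, hκu, fun s hs => hφ1 (subset_closure hs)⟩,
      ⟨closure v, isClosed_closure, hvβ, fun s hs => hφ0 fun h => hs (subset_closure h)⟩,
      fun x => hmul _ continuous_const ‖x‖ fun _ => le_rfl, fun f hf => ?_⟩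
    obtain ⟨C, hC⟩ := hf.2.isBounded.exists_norm_le
    exact hmul f hf.1 C fun s => hC _ ⟨s, rfl⟩

/-- Smooth cutoff functions for a compact subset of an open set. -/
theorem exists_smooth_cutoff {E : Type*} [NormedAddCommGroup E] [NormedSpace ℝ E]
    [FiniteDimensional ℝ E] {κ β : Set E} (hκ : IsCompact κ) (hβ : IsOpen β) (hκβ : κ ⊆ β) :
    ∃ φ : E → ℝ, ContDiff ℝ ∞ φ ∧ (∀ s, φ s ∈ Icc (0 : ℝ) 1) ∧ HasCompactSupport φ ∧
      tsupport φ ⊆ β ∧ ∃ w, IsOpen w ∧ κ ⊆ w ∧ ∀ s ∈ w, φ s = 1 := by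
  have : ProperSpace E := FiniteDimensional.proper ℝ E
  obtain ⟨L, hL, hκL, hLβ⟩ := exists_compact_between hκ hβ hκβ
  -- The second compact set M provides an open neighbourhood of κ on which φ is 1; L carries the
  -- support.
  obtain ⟨M, hM, hκM, hML⟩ := exists_compact_between hκ isOpen_interior hκL
  obtain ⟨φ, hφ0, hφ1, hφ⟩ := exists_contMDiffMap_zero_one_of_isClosed (n := ⊤) 𝓘(ℝ, E)
    (isOpen_interior (s := L)).isClosed_compl hM.isClosed
    (disjoint_left.2 fun s hs hs' => hs (hML hs'))
  have hsupp : tsupport φ ⊆ L := closure_minimal (fun s hs => by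
    by_contra h
    exact hs (hφ0 fun h' => h (interior_subset h'))) hL.isClosed
  exact ⟨φ, φ.contMDiff.contDiff, hφ, hL.of_isClosed_subset (isClosed_tsupport _) hsupp,
    hsupp.trans hLβ, interior M, isOpen_interior, hκM, fun s hs => hφ1 (interior_subset hs)⟩

/-- Since Ω is open, cutoffs are built in E around the image of κ and restricted to Ω. A compact
support in E that is contained in Ω stays compact in the subspace. -/
theorem isCutoffSystem_CcSmooth {E : Type*} [NormedAddCommGroup E] [NormedSpace ℝ E]
    [FiniteDimensional ℝ E] (Ω : TopologicalSpace.Opens E) {X : Type*} [NormedAddCommGroup X]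
    [NormedSpace ℝ X] : IsCutoffSystem {κ : Set Ω | IsCompact κ} (CcSmooth Ω X) where
  isClosed := fun _ h => IsCompact.isClosed h
  empty_mem := isCompact_empty
  union_mem := fun _ h _ h' => IsCompact.union h h'
  inter_mem := fun _ h _ h' => IsCompact.inter_right h h'
  continuous := by
    rintro f ⟨g, hg⟩
    rw [funext hg]
    exact g.continuous.comp continuous_subtype_val
  bounded := by
    rintro f ⟨g, hg⟩
    obtain ⟨C, hC⟩ := g.hasCompactSupport.exists_bound_of_continuous g.continuous
    exact ⟨C, fun s => by rw [hg]; exact hC s⟩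
  supported := by
    rintro f ⟨g, hg⟩
    refine ⟨Subtype.val ⁻¹' tsupport g, ?_, subset_univ _, fun s hs => ?_⟩
    · refine (Topology.IsInducing.subtypeVal.isCompact_preimage_iff ?_).2 g.hasCompactSupport
      rw [Subtype.range_coe]
      exact g.tsupport_subset
    · rw [hg]
      exact image_eq_zero_of_notMem_tsupport hs
  exists_cutoff := by
    intro κ hκ β hβ hκβ
    obtain ⟨φ, hφs, hφ, hφc, hφβ, w, hw, hκw, hw1⟩ := exists_smooth_cutoff
      (IsCompact.image hκ continuous_subtype_val) (Ω.isOpen.isOpenMap_subtype_val β hβ)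
      (image_mono hκβ)
    have hφΩ : tsupport φ ⊆ Ω := hφβ.trans (by rintro _ ⟨s, -, rfl⟩; exact s.2)
    have hmul : ∀ g : E → X, ContDiff ℝ ∞ g → (fun s : Ω => φ s • g s) ∈ CcSmooth Ω X := fun g hg =>
      ⟨⟨fun s => φ s • g s, hφs.smul hg, hφc.smul_right,
        (tsupport_smul_subset_left φ g).trans hφΩ⟩, fun s => rfl⟩
    refine ⟨fun s => φ s, fun s => hφ s, ⟨Subtype.val ⁻¹' w, hw.preimage continuous_subtype_val,
      fun s hs => hκw ⟨s, hs, rfl⟩, fun s hs => hw1 s hs⟩,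
      ⟨Subtype.val ⁻¹' tsupport φ, ?_, fun s hs => ?_, fun s hs => ?_⟩,
      fun x => hmul _ contDiff_const, ?_⟩
    · refine (Topology.IsInducing.subtypeVal.isCompact_preimage_iff ?_).2 hφc
      rwa [Subtype.range_coe]
    · obtain ⟨t, ht, hts⟩ := hφβ hs
      rwa [← Subtype.ext hts]
    · exact image_eq_zero_of_notMem_tsupport hs
    · rintro f ⟨g, hg⟩
      rw [funext hg]
      exact hmul g g.contDiff

end ConcreteSystems

/-! ### The representation theorem for the two pairs. -/

theorem theorem1p3 {n m : ℕ} (Ω : TopologicalSpace.Opens (EuclideanSpace ℝ (Fin n)))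
    {Z : Type*} [AddCommGroup Z] [Module ℝ Z] [UniformSpace Z] [IsUniformAddGroup Z]
    [ContinuousSMul ℝ Z] [T2Space Z]
    (hZ : ∀ E : Set Z, Bornology.IsVonNBounded ℝ E → RelativelyComplete E ∧ PerfectForSums E) :
    (∀ ℓ : Cp Ω (EuclideanSpace ℝ (Fin m)) →ₗ[ℝ] Z,
      ContinuousForUniformConvergence (Cp Ω (EuclideanSpace ℝ (Fin m))) ℓ →
      RepresentedByRieszMeasure {κ : Set Ω | IsClosed κ} {γ : Set Ω | IsOpen γ}
        (closedBalancedTotallyBounded (EuclideanSpace ℝ (Fin m)))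
        (Cp Ω (EuclideanSpace ℝ (Fin m))) ℓ) ∧
    (∀ ℓ : CcSmooth Ω (EuclideanSpace ℝ (Fin m)) →ₗ[ℝ] Z,
      ContinuousForUniformConvergence (CcSmooth Ω (EuclideanSpace ℝ (Fin m))) ℓ →
      RepresentedByRieszMeasure {κ : Set Ω | IsCompact κ} {γ : Set Ω | IsOpen γ}
        (closedBalancedTotallyBounded (EuclideanSpace ℝ (Fin m)))
        (CcSmooth Ω (EuclideanSpace ℝ (Fin m))) ℓ) :=
  ⟨fun _ hℓ => isCutoffSystem_Cp.representedByRieszMeasure (.of_continuous hZ hℓ),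
    fun _ hℓ => (isCutoffSystem_CcSmooth Ω).representedByRieszMeasure (.of_continuous hZ hℓ)⟩
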